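/- An instance of \textsc{MaxLin2-AA}$[k]$ consists of a system $S$ of $m$ equations $\prod_{i\in I_j}x_i=b_j$ ($j=1,\dots,m$) in variables $x_1,\dots,x_n\in\{-1,1\}$, where $\emptyset\ne I_j\subseteq\{1,\dots,n\}$, $b_j\in\{-1,1\}$, and equation $j$ has a positive integral weight $w_j$, together with a nonnegative integer $k$, the parameter. The question is whether $\mathrm{sat}(S)\ge W/2+k$, where $W=\sum_{j}w_j$ and $\mathrm{sat}(S)$ is the maximum total weight of equations of $S$ that can be satisfied simultaneously. Statement: \textsc{MaxLin2-AA}$[k]$ can be solved in time $2^{O(k\log k)}(nm)^{O(1)}$. Precisely, there are a single program for a random access machine and a constant $C$ such that, for all $n$, $m$, $k$ and $S$, the program, given the instance $(S,k)$ (the numbers $n,m,k$, the $m\times n$ incidence matrix of the sets $I_j$, the $b_j$ and the $w_j$), halts with the correct answer after at most $C\cdot 2^{C k\log_2 k}\,(nm+1)^{C}$ steps (with $0\log_2 0=0$). Here each addition, subtraction or comparison of two integers and each memory access (with indirect addressing) counts as one step; multiplication is not an elementary operation. -/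

import Mathlib

/-! ## The problem MaxLin2-AA -/

/-- A weighted system of `m` equations `∏ i ∈ I_j, x_i = b_j` in `n` variables, where
`x_i, b_j ∈ {-1, 1}` (the units of `ℤ`), every `I_j` is a nonempty set of variables, and
every equation carries a positive integral weight `w_j`. -/
structure LinSystem (n m : ℕ) where
  supp : Fin m → Finset (Fin n)
  rhs : Fin m → ℤˣ
  weight : Fin m → ℕ
  supp_nonempty : ∀ j, (supp j).Nonempty
  weight_pos : ∀ j, 0 < weight j

namespace LinSystem

variable {n m : ℕ}

/-- The total weight `W` of all equations. -/
def totalWeight (S : LinSystem n m) : ℕ := ∑ j, S.weight j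

/-- The total weight of the equations satisfied by the assignment `x`. -/
def satWeight (S : LinSystem n m) (x : Fin n → ℤˣ) : ℕ :=
  ∑ j, if ∏ i ∈ S.supp j, x i = S.rhs j then S.weight j else 0

/-- `sat(S)`: the maximum total weight of equations that can be satisfied simultaneously. -/
def sat (S : LinSystem n m) : ℕ :=
  Finset.univ.sup' Finset.univ_nonempty S.satWeight

/-- The question of MaxLin2-AA: is `sat(S) ≥ W/2 + k`? -/
def IsYes (S : LinSystem n m) (k : ℕ) : Prop :=
  (S.totalWeight : ℚ) / 2 + k ≤ S.sat

end LinSystem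

/-! ## The machine model

A random access machine with unit-cost integer arithmetic, restricted to addition, subtraction
and comparison (there is no multiplication), programmed in a structured way. The store consists
of integer variables and of integer arrays with computed (indirect) addressing; a program
mentions only finitely many variables and arrays, by fixed names. Every elementary operation
costs one step. -/

namespace RAM

/-- A store: the values of the variables, and the contents `arr a z` of cell `z` of array `a`. -/
structure Store where
  var : ℕ → ℤ
  arr : ℕ → ℤ → ℤ

/-- Assign the value `v` to the variable `x`. -/
def Store.setVar (s : Store) (x : ℕ) (v : ℤ) : Store :=
  { s with var := Function.update s.var x v }

/-- Write the value `v` into cell `z` of the array `a`. -/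
def Store.setArr (s : Store) (a : ℕ) (z v : ℤ) : Store :=
  { s with arr := Function.update s.arr a (Function.update (s.arr a) z v) }

/-- Integer expressions; `get a e` reads cell `e` of the array `a`. -/
inductive Expr where
  | const (c : ℤ)
  | var (x : ℕ)
  | get (a : ℕ) (e : Expr)
  | add (e₁ e₂ : Expr)
  | sub (e₁ e₂ : Expr)

/-- The value of an expression. -/
def Expr.eval (s : Store) : Expr → ℤ
  | .const c => c
  | .var x => s.var x
  | .get a e => s.arr a (e.eval s)
  | .add e₁ e₂ => e₁.eval s + e₂.eval s
  | .sub e₁ e₂ => e₁.eval s - e₂.eval s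

/-- The number of elementary operations in the evaluation of an expression. -/
def Expr.cost : Expr → ℕ
  | .const _ => 1
  | .var _ => 1
  | .get _ e => e.cost + 1
  | .add e₁ e₂ => e₁.cost + e₂.cost + 1
  | .sub e₁ e₂ => e₁.cost + e₂.cost + 1

/-- Tests. -/
inductive Test where
  | le (e₁ e₂ : Expr)
  | eq (e₁ e₂ : Expr)
  | not (t : Test)
  | and (t₁ t₂ : Test)

/-- The truth value of a test. -/
def Test.Holds (s : Store) : Test → Prop
  | .le e₁ e₂ => e₁.eval s ≤ e₂.eval s
  | .eq e₁ e₂ => e₁.eval s = e₂.eval s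
  | .not t => ¬ t.Holds s
  | .and t₁ t₂ => t₁.Holds s ∧ t₂.Holds s

/-- The number of elementary operations in the evaluation of a test. -/
def Test.cost : Test → ℕ
  | .le e₁ e₂ => e₁.cost + e₂.cost + 1
  | .eq e₁ e₂ => e₁.cost + e₂.cost + 1
  | .not t => t.cost + 1
  | .and t₁ t₂ => t₁.cost + t₂.cost + 1

/-- Programs: `assign x e` is `x := e`, and `store a e₁ e₂` is `a[e₁] := e₂`. -/
inductive Prog where
  | skip
  | assign (x : ℕ) (e : Expr)
  | store (a : ℕ) (e₁ e₂ : Expr)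
  | seq (p q : Prog)
  | ite (t : Test) (p q : Prog)
  | while (t : Test) (p : Prog)

/-- `Exec p s T s'`: started in the store `s`, the program `p` halts in the store `s'` after
exactly `T` steps. -/
inductive Exec : Prog → Store → ℕ → Store → Prop
  | skip (s : Store) : Exec .skip s 1 s
  | assign (x : ℕ) (e : Expr) (s : Store) :
      Exec (.assign x e) s (e.cost + 1) (s.setVar x (e.eval s))
  | store (a : ℕ) (e₁ e₂ : Expr) (s : Store) :
      Exec (.store a e₁ e₂) s (e₁.cost + e₂.cost + 1) (s.setArr a (e₁.eval s) (e₂.eval s))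
  | seq {p q : Prog} {s s' s'' : Store} {T T' : ℕ} :
      Exec p s T s' → Exec q s' T' s'' → Exec (.seq p q) s (T + T') s''
  | ite_true {t : Test} {p q : Prog} {s s' : Store} {T : ℕ} :
      t.Holds s → Exec p s T s' → Exec (.ite t p q) s (t.cost + 1 + T) s'
  | ite_false {t : Test} {p q : Prog} {s s' : Store} {T : ℕ} :
      ¬ t.Holds s → Exec q s T s' → Exec (.ite t p q) s (t.cost + 1 + T) s'
  | while_true {t : Test} {p : Prog} {s s' s'' : Store} {T T' : ℕ} :
      t.Holds s → Exec p s T s' → Exec (.while t p) s' T' s'' →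
      Exec (.while t p) s (t.cost + 1 + T + T') s''
  | while_false {t : Test} {p : Prog} {s : Store} :
      ¬ t.Holds s → Exec (.while t p) s (t.cost + 1) s

/-- Programs are deterministic: the running time and the final store are determined by the
initial store. -/
theorem Exec.deterministic {p : Prog} {s s₁ s₂ : Store} {T₁ T₂ : ℕ}
    (h₁ : Exec p s T₁ s₁) (h₂ : Exec p s T₂ s₂) : T₁ = T₂ ∧ s₁ = s₂ := by
  induction h₁ generalizing T₂ s₂ with
  | skip s => cases h₂; exact ⟨rfl, rfl⟩
  | assign x e s => cases h₂; exact ⟨rfl, rfl⟩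
  | store a e₁ e₂ s => cases h₂; exact ⟨rfl, rfl⟩
  | seq _ _ ih ih' =>
    cases h₂ with
    | seq a b =>
      obtain ⟨rfl, rfl⟩ := ih a
      obtain ⟨rfl, rfl⟩ := ih' b
      exact ⟨rfl, rfl⟩
  | ite_true ht _ ih =>
    cases h₂ with
    | ite_true _ a => obtain ⟨rfl, rfl⟩ := ih a; exact ⟨rfl, rfl⟩
    | ite_false hf _ => exact absurd ht hf
  | ite_false hf _ ih =>
    cases h₂ with
    | ite_true ht _ => exact absurd ht hf
    | ite_false _ a => obtain ⟨rfl, rfl⟩ := ih a; exact ⟨rfl, rfl⟩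
  | while_true ht _ _ ih ih' =>
    cases h₂ with
    | while_true _ a b =>
      obtain ⟨rfl, rfl⟩ := ih a
      obtain ⟨rfl, rfl⟩ := ih' b
      exact ⟨rfl, rfl⟩
    | while_false hf => exact absurd ht hf
  | while_false hf =>
    cases h₂ with
    | while_true ht _ _ => exact absurd ht hf
    | while_false _ => exact ⟨rfl, rfl⟩

end RAM

open Classical in
/-- The initial store for the instance `(S, k)` of MaxLin2-AA. Variables `0`, `1`, `2` hold
`n`, `m`, `k`. Array `0` holds the incidence matrix of the system, row by row: cell `j * n + i`
is `1` if the variable `x_i` occurs in equation `j`, and `0` otherwise. Cell `j` of array `1`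
holds `b_j`, and cell `j` of array `2` holds `w_j`. Everything else is `0`. -/
noncomputable def LinSystem.input {n m : ℕ} (S : LinSystem n m) (k : ℕ) : RAM.Store where
  var := fun x =>
    match x with
    | 0 => n
    | 1 => m
    | 2 => k
    | _ => 0
  arr := fun a z =>
    match a with
    | 0 => if ∃ (j : Fin m) (i : Fin n), z = (j : ℤ) * n + (i : ℤ) ∧ i ∈ S.supp j then 1 else 0
    | 1 => ∑ j : Fin m, if z = (j : ℤ) then (S.rhs j : ℤ) else 0
    | 2 => ∑ j : Fin m, if z = (j : ℤ) then (S.weight j : ℤ) else 0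
    | _ => 0

/-- The program `p`, run on the instance `(S, k)` of MaxLin2-AA, halts within `B` steps and
returns the correct answer in variable `0`: the value `1` for Yes and `0` for No. -/
def SolvesWithin {n m : ℕ} (p : RAM.Prog) (S : LinSystem n m) (k : ℕ) (B : ℝ) : Prop :=
  ∃ (T : ℕ) (s : RAM.Store), RAM.Exec p (S.input k) T s ∧ (T : ℝ) ≤ B ∧
    (S.IsYes k → s.var 0 = 1) ∧ (¬ S.IsYes k → s.var 0 = 0)

/-! The excess of an assignment is the satisfied weight minus the falsified weight, so the answer is
Yes iff some excess is at least `K = 2k`. The excess is an integer combination of characters of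
`{-1, 1} ^ n` whose constant term is initially 0. Its mean over all assignments is the constant
term, and eliminating a variable only restricts the values it takes. Hence a constant term of at
least `K`, reached by any sequence of eliminations, proves Yes.

Branching: take a maximal independent list of equations whose characters have nonzero coefficient,
each oriented by the sign of its net weight. An assignment of excess at least `K` may go against all
of them. Then every remaining character is determined, and falsifying the whole list leaves that
excess as constant term (`coeff_scan`). Otherwise it agrees with one of them, and imposing this one
keeps the assignment and raises the constant term by at least 1 (`coeff_impose`). So `K + 1` levels
suffice (`exists_run`).

Long lists: if `(m+1)^K ≤ 2^R`, the list has more than `R` entries and the constant term is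
nonnegative, the answer is Yes anyway (`exists_excess_gt`). The span of the vectors is then too
large to consist of sums of at most `K` of them. A shortest representation of a missed element is a
set `T` of more than `K` vectors in which no sum of two or more is 0 or again one of the vectors
(`exists_sumFree`). The Riesz product over `T` is a nonnegative weight under which the mean excess
is the constant term plus the absolute values of the coefficients on `T`.

So there are `R + 1` children per node with `R = O(k log m)`, and `(R + 1) ^ (2k + 1)` branches. The
factor `(log m)^O(k)` is at most `k^O(k)` times a polynomial in `m` (`pow_le_pow_mul_two_pow`,
`search_size_le`). Branches are numbers in base `R + 1`, so the machine replaces recursion by a loop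
over these numbers, following each branch from the root. -/

namespace LinSystem

/-! ### Systems as sums of signed characters -/

/-- The character of `{-1, 1} ^ n` with exponent vector `v`. -/
def chi {n : ℕ} (v : Fin n → ZMod 2) (x : Fin n → ℤˣ) : ℤˣ := ∏ i, x i ^ v i

theorem zmod_two_cases (a : ZMod 2) : a = 0 ∨ a = 1 := by
  revert a; decide

@[simp] theorem chi_zero {n : ℕ} (x : Fin n → ℤˣ) : chi 0 x = 1 := by
  simp [chi]

theorem chi_add {n : ℕ} (u v : Fin n → ZMod 2) (x : Fin n → ℤˣ) :
    chi (u + v) x = chi u x * chi v x := by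
  simp [chi, uzpow_add, Finset.prod_mul_distrib]

theorem chi_sum {n : ℕ} (U : Finset (Fin n → ZMod 2)) (x : Fin n → ℤˣ) :
    chi (∑ v ∈ U, v) x = ∏ v ∈ U, chi v x := by
  classical
  induction U using Finset.induction_on with
  | empty => simp
  | insert a s ha ih => rw [Finset.sum_insert ha, Finset.prod_insert ha, chi_add, ih]

theorem chi_update {n : ℕ} (v : Fin n → ZMod 2) (x : Fin n → ℤˣ) (q : Fin n) (g : ℤˣ) :
    chi v (Function.update x q (x q * g)) = chi v x * g ^ v q := by
  classical
  have h : ∀ y : Fin n → ℤˣ, chi v y = y q ^ v q * ∏ i ∈ Finset.univ.erase q, y i ^ v i :=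
    fun y => (Finset.mul_prod_erase _ _ (Finset.mem_univ q)).symm
  rw [h, h x]
  have : ∏ i ∈ Finset.univ.erase q, Function.update x q (x q * g) i ^ v i
      = ∏ i ∈ Finset.univ.erase q, x i ^ v i :=
    Finset.prod_congr rfl fun i hi => by
      rw [Function.update_of_ne (Finset.ne_of_mem_erase hi)]
  rw [this, Function.update_self, mul_uzpow]
  exact mul_right_comm _ _ _

theorem sum_chi {n : ℕ} (v : Fin n → ZMod 2) :
    ∑ x : Fin n → ℤˣ, ((chi v x : ℤˣ) : ℤ) = if v = 0 then 2 ^ n else 0 := by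
  classical
  split_ifs with h
  · subst h; simp
  · obtain ⟨q, hq⟩ : ∃ q, v q ≠ 0 := by
      by_contra hc; push Not at hc; exact h (funext hc)
    -- Flipping the sign of coordinate `q` is a bijection that negates the character, so the sum
    -- equals its own negative.
    have hq1 : v q = 1 := (zmod_two_cases _).resolve_left hq
    have hinv : Function.Involutive
        fun x : Fin n → ℤˣ => Function.update x q (x q * (-1)) := by
      intro x; simp
    have := Equiv.sum_comp hinv.toPerm fun x : Fin n → ℤˣ => ((chi v x : ℤˣ) : ℤ)
    simp only [Function.Involutive.coe_toPerm, chi_update, hq1, uzpow_one] at this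
    simp only [Units.val_neg, mul_neg, mul_one,
      Finset.sum_neg_distrib] at this
    linarith

/-- The left-hand sides (as vectors over `ZMod 2`) and the right-hand sides of the equations. -/
structure State (n m : ℕ) where
  A : Fin m → Fin n → ZMod 2
  σ : Fin m → ℤˣ

namespace State

variable {n m : ℕ}

/-- `1` if the assignment satisfies equation `j`, and `-1` otherwise. -/
def val (st : State n m) (j : Fin m) (x : Fin n → ℤˣ) : ℤˣ := st.σ j * chi (st.A j) x

/-- The excess of an assignment: the weight it satisfies minus the weight it falsifies. -/
def excess (w : Fin m → ℕ) (st : State n m) (x : Fin n → ℤˣ) : ℤ :=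
  ∑ j, (w j : ℤ) * (st.val j x : ℤˣ)

/-- The coefficient of the character with exponent vector `v` in the excess. -/
def coeff (w : Fin m → ℕ) (st : State n m) (v : Fin n → ZMod 2) : ℤ :=
  ∑ j, if st.A j = v then (w j : ℤ) * (st.σ j : ℤˣ) else 0

/-- The coefficient of the character of equation `p`, relative to the sign of this equation. -/
def net (w : Fin m → ℕ) (st : State n m) (p : Fin m) : ℤ :=
  ∑ j, if st.A j = st.A p then (if st.σ j = st.σ p then (w j : ℤ) else -w j) else 0

theorem units_mul_eq (a b : ℤˣ) (w : ℤ) :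
    (if a = b then w else -w) = (b : ℤ) * (w * a) := by
  rcases Int.units_eq_one_or a with rfl | rfl <;> rcases Int.units_eq_one_or b with rfl | rfl <;>
    simp

theorem net_eq (w : Fin m → ℕ) (st : State n m) (p : Fin m) :
    st.net w p = (st.σ p : ℤ) * st.coeff w (st.A p) := by
  unfold net coeff
  rw [Finset.mul_sum]
  refine Finset.sum_congr rfl fun j _ => ?_
  by_cases h : st.A j = st.A p
  · rw [if_pos h, if_pos h]
    exact units_mul_eq (st.σ j) (st.σ p) (w j)
  · simp [h]

theorem coeff_eq (w : Fin m → ℕ) (st : State n m) (p : Fin m) :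
    st.coeff w (st.A p) = (st.σ p : ℤ) * st.net w p := by
  rw [net_eq]
  rcases Int.units_eq_one_or (st.σ p) with h | h <;> simp [h]

/-- Fourier inversion by orthogonality of characters. With `v = 0` it says that the constant term is
the mean of the excess. -/
theorem sum_excess_mul_chi (w : Fin m → ℕ) (st : State n m) (v : Fin n → ZMod 2) :
    ∑ x, (chi v x : ℤ) * st.excess w x = 2 ^ n * st.coeff w v := by
  classical
  have hz : ∀ u : Fin n → ZMod 2, v + u = 0 ↔ u = v := by
    intro u
    constructor
    · intro h
      funext i
      have := congrFun h i
      simp only [Pi.add_apply, Pi.zero_apply] at this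
      rcases zmod_two_cases (v i) with h1 | h1 <;> rcases zmod_two_cases (u i) with h2 | h2 <;>
        simp_all
    · rintro rfl; funext i; exact CharTwo.add_self_eq_zero _
  simp only [excess, coeff, Finset.mul_sum]
  rw [Finset.sum_comm]
  refine Finset.sum_congr rfl fun j _ => ?_
  have : ∀ x, (chi v x : ℤ) * ((w j : ℤ) * (st.val j x : ℤˣ))
      = (w j : ℤ) * (st.σ j : ℤˣ) * (chi (v + st.A j) x : ℤˣ) := by
    intro x
    rw [chi_add, val]
    push_cast
    ring
  simp only [this]
  rw [← Finset.mul_sum, sum_chi]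
  simp only [hz]
  split_ifs <;> ring

theorem sum_excess (w : Fin m → ℕ) (st : State n m) :
    ∑ x, st.excess w x = 2 ^ n * st.coeff w 0 := by
  simpa using st.sum_excess_mul_chi w 0

theorem exists_excess_ge_coeff_zero (w : Fin m → ℕ) (st : State n m) :
    ∃ x, st.coeff w 0 ≤ st.excess w x := by
  by_contra! h
  have h1 := Finset.sum_lt_sum_of_nonempty (s := Finset.univ)
    (Finset.univ_nonempty (α := Fin n → ℤˣ)) fun x _ => h x
  rw [sum_excess] at h1
  simp at h1

/-! ### Substitution -/

/-- Impose `chi (A p) x = g` by eliminating the variable `q`. -/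
def elim (st : State n m) (p : Fin m) (q : Fin n) (g : ℤˣ) : State n m where
  A j := if st.A j q = 0 then st.A j else st.A j + st.A p
  σ j := if st.A j q = 0 then st.σ j else g * st.σ j

/-- The assignment with `x q` changed so that `chi (A p) x = g`. -/
def adjust (st : State n m) (p : Fin m) (q : Fin n) (g : ℤˣ) (x : Fin n → ℤˣ) : Fin n → ℤˣ :=
  Function.update x q (x q * (g * chi (st.A p) x))

theorem adjust_eq_self (st : State n m) (p : Fin m) (q : Fin n) (g : ℤˣ)
    {x : Fin n → ℤˣ} (hx : chi (st.A p) x = g) : st.adjust p q g x = x := by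
  rw [adjust, hx, Int.units_mul_self, mul_one, Function.update_eq_self]

/-- Elimination is composition with a map of assignments. This is why every excess of the reduced
system is an excess of the original one. -/
theorem val_elim (st : State n m) (p : Fin m) (q : Fin n) (g : ℤˣ) (j : Fin m)
    (x : Fin n → ℤˣ) : (st.elim p q g).val j x = st.val j (st.adjust p q g x) := by
  unfold val elim adjust
  rw [chi_update]
  rcases zmod_two_cases (st.A j q) with h | h
  · simp [h]
  · simp only [h, one_ne_zero, if_false, uzpow_one, chi_add]
    ac_rfl

/-- Elimination sends `v` to `v` or `v + A p` according to `v q`, so exactly the characters `0` and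
`A p` become constant, the latter with value `g`. -/
theorem coeff_elim (w : Fin m → ℕ) (st : State n m) {p : Fin m} {q : Fin n}
    (hq : st.A p q ≠ 0) (g : ℤˣ) :
    (st.elim p q g).coeff w 0 = st.coeff w 0 + (g : ℤ) * st.coeff w (st.A p) := by
  unfold coeff
  rw [Finset.mul_sum, ← Finset.sum_add_distrib]
  refine Finset.sum_congr rfl fun j _ => ?_
  have hz : st.A j + st.A p = 0 ↔ st.A j = st.A p := by
    rw [add_eq_zero_iff_eq_neg]
    have : -st.A p = st.A p := by funext i; exact CharTwo.neg_eq _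
    rw [this]
  have hp : st.A p ≠ 0 := fun h => hq (by rw [h]; rfl)
  by_cases h : st.A j q = 0
  · have h1 : st.A j ≠ st.A p := fun h2 => hq (by rw [← h2]; exact h)
    simp [elim, h, h1]
  · have h1 : st.A j ≠ 0 := fun h2 => h (by rw [h2]; rfl)
    simp only [elim, h, if_false, hz, h1]
    split_ifs
    · push_cast; ring
    · simp

end State

/-! ### Scanning for independent equations and branching on them -/

/-- Iterate `f 0, f 1, …` for `t` rounds. -/
def iter {α : Type*} {N : ℕ} (f : Fin N → α → α) (a : α) : ℕ → α
  | 0 => a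
  | t + 1 => if h : t < N then f ⟨t, h⟩ (iter f a t) else iter f a t

theorem iter_succ {α : Type*} {N : ℕ} (f : Fin N → α → α) (a : α) (t : Fin N) :
    iter f a (t + 1) = f t (iter f a t) := by
  simp [iter]

/-- The last nonzero entry of a vector. -/
def pivot {n : ℕ} (v : Fin n → ZMod 2) : Option (Fin n) :=
  iter (fun i a => if v i = 0 then a else some i) none n

theorem pivot_aux {n : ℕ} (v : Fin n → ZMod 2) (t : ℕ) (ht : t ≤ n) :
    (iter (fun i a => if v i = 0 then a else some i) none t = none → ∀ i : Fin n, i < t → v i = 0) ∧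
    ∀ q, iter (fun i a => if v i = 0 then a else some i) none t = some q → v q ≠ 0 := by
  induction t with
  | zero => simp [iter]
  | succ t ih =>
    obtain ⟨h1, h2⟩ := ih (by omega)
    rw [iter_succ (t := ⟨t, by omega⟩)]
    by_cases h : v ⟨t, by omega⟩ = 0
    · simp only [h, if_true]
      refine ⟨fun hn i hi => ?_, h2⟩
      rcases Nat.lt_succ_iff_lt_or_eq.1 hi with h3 | h3
      · exact h1 hn i h3
      · have : i = ⟨t, by omega⟩ := Fin.ext h3
        rw [this]; exact h
    · simp only [h, if_false]
      refine ⟨fun hn => (Option.some_ne_none _ hn).elim, fun q hq => ?_⟩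
      cases hq
      exact h

theorem pivot_eq_none {n : ℕ} {v : Fin n → ZMod 2} (h : pivot v = none) : v = 0 :=
  funext fun i => (pivot_aux v n le_rfl).1 h i i.2

theorem pivot_eq_some {n : ℕ} {v : Fin n → ZMod 2} {q : Fin n} (h : pivot v = some q) : v q ≠ 0 :=
  (pivot_aux v n le_rfl).2 q h

theorem pivot_eq_none_iff {n : ℕ} {v : Fin n → ZMod 2} : pivot v = none ↔ v = 0 := by
  refine ⟨pivot_eq_none, ?_⟩
  rintro rfl
  cases h : pivot (0 : Fin n → ZMod 2) with
  | none => rfl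
  | some q => exact (pivot_eq_some h rfl).elim

namespace State

variable {n m : ℕ}

/-- Impose `chi (A p) x = g` by eliminating the last variable of equation `p`. -/
def impose (st : State n m) (p : Fin m) (g : ℤˣ) : State n m :=
  match pivot (st.A p) with
  | none => st
  | some q => st.elim p q g

/-- One round of `scan`. -/
def scanStep (w : Fin m → ℕ) (st : State n m) (p : Fin m) (a : State n m × List (Fin m)) :
    State n m × List (Fin m) :=
  if st.net w p = 0 then a else
  if pivot (a.1.A p) = none then a else
  (a.1.impose p (if st.net w p ≤ 0 then a.1.σ p else -a.1.σ p), a.2 ++ [p])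

/-- Go through the equations with nonzero net weight, list a maximal independent set of them,
and falsify all equations of this set. -/
def scan (w : Fin m → ℕ) (st : State n m) : State n m × List (Fin m) :=
  iter (st.scanStep w) (st, []) m

/-- One branching step: satisfy the equation number `d` of the list, or falsify all of them if
there is no such equation. -/
def level (w : Fin m → ℕ) (st : State n m) (d : ℕ) : State n m :=
  match (st.scan w).2[d]? with
  | none => (st.scan w).1
  | some p => st.impose p (if st.net w p ≤ 0 then -st.σ p else st.σ p)

/-- The two ways to recognize a Yes-instance at a node of the search tree. -/
def Good (w : Fin m → ℕ) (K R : ℕ) (st : State n m) : Prop :=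
  (K : ℤ) ≤ st.coeff w 0 ∨ 0 ≤ st.coeff w 0 ∧ R < (st.scan w).2.length

/-- The search along the branch with number `v`. -/
def Run (w : Fin m → ℕ) (K R : ℕ) : ℕ → ℕ → State n m → Prop
  | 0, _, _ => False
  | t + 1, v, st => st.Good w K R ∨
      Run w K R t (v % (R + 1) ^ t) (st.level w (v / (R + 1) ^ t))

/-- The first half transports excesses back to the old system (soundness); the second says that
assignments already obeying the imposed equation survive (completeness). -/
theorem impose_val (st : State n m) (p : Fin m) (g : ℤˣ) :
    ∃ φ : (Fin n → ℤˣ) → Fin n → ℤˣ, (∀ j x, (st.impose p g).val j x = st.val j (φ x)) ∧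
      ∀ x, st.val p x = st.σ p * g → φ x = x := by
  unfold impose
  split
  · exact ⟨id, fun _ _ => rfl, fun _ _ => rfl⟩
  · next q _ =>
    exact ⟨st.adjust p q g, fun j x => st.val_elim p q g j x, fun x hx =>
      st.adjust_eq_self p q g (mul_left_cancel hx)⟩

theorem excess_of_val {w : Fin m → ℕ} {st st' : State n m}
    {φ : (Fin n → ℤˣ) → Fin n → ℤˣ} (h : ∀ j x, st'.val j x = st.val j (φ x))
    (x : Fin n → ℤˣ) : st'.excess w x = st.excess w (φ x) := by
  simp only [excess, h]

theorem impose_linear (st : State n m) (p : Fin m) (g : ℤˣ) :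
    ∃ Λ : (Fin n → ZMod 2) →ₗ[ZMod 2] (Fin n → ZMod 2),
      (∀ j, (st.impose p g).A j = Λ (st.A j)) ∧ Λ (st.A p) = 0 := by
  unfold impose
  split
  · next h => exact ⟨LinearMap.id, fun _ => rfl, pivot_eq_none h⟩
  · next q h =>
    have hq := pivot_eq_some h
    have h1 : ∀ v : Fin n → ZMod 2, (if v q = 0 then v else v + st.A p) = v + v q • st.A p := by
      intro v
      rcases zmod_two_cases (v q) with h | h <;> simp [h]
    refine ⟨LinearMap.id + (LinearMap.proj q).smulRight (st.A p), fun j => ?_, ?_⟩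
    · simp [elim, h1]
    · simp only [LinearMap.add_apply, LinearMap.id_apply, LinearMap.smulRight_apply,
        LinearMap.proj_apply, (zmod_two_cases _).resolve_left hq, one_smul]
      funext i; exact CharTwo.add_self_eq_zero _

/-- The vectors of the first `t` equations that have nonzero net weight. -/
def support (w : Fin m → ℕ) (st : State n m) (t : ℕ) : Set (Fin n → ZMod 2) :=
  {v | ∃ p : Fin m, p < t ∧ st.net w p ≠ 0 ∧ st.A p = v}

theorem support_succ_of_eq (w : Fin m → ℕ) (st : State n m) (t : Fin m) (h : st.net w t = 0) :
    st.support w (t + 1) = st.support w t := by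
  ext v
  constructor
  · rintro ⟨p, hp, h1, h2⟩
    refine ⟨p, ?_, h1, h2⟩
    rcases Nat.lt_succ_iff_lt_or_eq.1 hp with h3 | h3
    · exact h3
    · exact (h1 (by rw [Fin.ext h3]; exact h)).elim
  · rintro ⟨p, hp, h1, h2⟩
    exact ⟨p, by omega, h1, h2⟩

theorem support_succ_of_ne (w : Fin m → ℕ) (st : State n m) (t : Fin m) (h : st.net w t ≠ 0) :
    st.support w (t + 1) = insert (st.A t) (st.support w t) := by
  ext v
  constructor
  · rintro ⟨p, hp, h1, h2⟩
    rcases Nat.lt_succ_iff_lt_or_eq.1 hp with h3 | h3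
    · exact Or.inr ⟨p, h3, h1, h2⟩
    · left; rw [← h2, Fin.ext h3]
  · rintro (rfl | ⟨p, hp, h1, h2⟩)
    · exact ⟨t, Nat.lt_succ_self _, h, rfl⟩
    · exact ⟨p, by omega, h1, h2⟩

/-- What is known after `t` rounds of the scan. -/
structure ScanInv (w : Fin m → ℕ) (st : State n m) (t : ℕ) (a : State n m × List (Fin m)) :
    Prop where
  val : ∃ φ : (Fin n → ℤˣ) → Fin n → ℤˣ, (∀ j x, a.1.val j x = st.val j (φ x)) ∧
    ∀ x, (∀ p ∈ a.2, st.val p x = if st.net w p ≤ 0 then 1 else -1) → φ x = x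
  linear : ∃ Λ : (Fin n → ZMod 2) →ₗ[ZMod 2] (Fin n → ZMod 2),
    (∀ j, a.1.A j = Λ (st.A j)) ∧ ∀ v ∈ st.support w t, Λ v = 0
  rank : a.2.length ≤ Module.finrank (ZMod 2) (Submodule.span (ZMod 2) (st.support w t))
  mem : ∀ p ∈ a.2, st.net w p ≠ 0 ∧ st.A p ≠ 0

/-- The composite elimination acts linearly on left-hand sides and kills all vectors treated so far.
A reduced vector that is nonzero is therefore outside their span, and listing it raises the rank. -/
theorem scan_inv_aux (w : Fin m → ℕ) (st : State n m) (t : ℕ) (ht : t ≤ m) :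
    ScanInv w st t (iter (st.scanStep w) (st, []) t) := by
  induction t with
  | zero =>
    exact ⟨⟨id, fun _ _ => rfl, fun _ _ => rfl⟩, ⟨LinearMap.id, fun _ => rfl,
      fun v ⟨p, hp, _⟩ => (Nat.not_lt_zero _ hp).elim⟩, by simp [iter], by simp [iter]⟩
  | succ t ih =>
    have ih := ih (by omega)
    obtain ⟨p, hpt⟩ : ∃ p : Fin m, (p : ℕ) = t := ⟨⟨t, by omega⟩, rfl⟩
    have key := iter_succ (st.scanStep w) (st, []) p
    have hsupp0 := support_succ_of_eq w st p
    have hsupp1 := support_succ_of_ne w st p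
    rw [hpt] at key hsupp0 hsupp1
    rw [key]
    generalize iter (st.scanStep w) (st, []) t = a at ih ⊢
    obtain ⟨⟨φ, hφ, hφ1⟩, ⟨Λ, hΛ, hΛ1⟩, hr, hm⟩ := ih
    unfold scanStep
    by_cases h : st.net w p = 0
    · rw [if_pos h]
      have := hsupp0 h
      exact ⟨⟨φ, hφ, hφ1⟩, ⟨Λ, hΛ, by rwa [this]⟩, by rwa [this], hm⟩
    rw [if_neg h]
    have hs := hsupp1 h
    by_cases h1 : pivot (a.1.A p) = none
    · rw [if_pos h1]
      have h0 : Λ (st.A p) = 0 := by rw [← hΛ]; exact pivot_eq_none h1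
      refine ⟨⟨φ, hφ, hφ1⟩, ⟨Λ, hΛ, ?_⟩, ?_, hm⟩
      · rw [hs]
        rintro v (rfl | hv)
        · exact h0
        · exact hΛ1 v hv
      · refine hr.trans (Submodule.finrank_mono (Submodule.span_mono ?_))
        rw [hs]; exact Set.subset_insert _ _
    rw [if_neg h1]
    have h0 : Λ (st.A p) ≠ 0 := by rw [← hΛ]; exact fun hc => h1 (pivot_eq_none_iff.2 hc)
    refine ⟨?_, ?_, ?_, ?_⟩
    · obtain ⟨ψ, hψ, hψ1⟩ := a.1.impose_val p (if st.net w p ≤ 0 then a.1.σ p else -a.1.σ p)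
      refine ⟨φ ∘ ψ, fun j x => by rw [hψ, hφ]; rfl, fun x hx => ?_⟩
      have hx1 : φ x = x := hφ1 x fun p hp => hx p (List.mem_append_left _ hp)
      have hx2 := hx p (by simp)
      have : ψ x = x := by
        apply hψ1
        -- Since `φ` fixes `x`, the current and the original equation `p` have the same value at
        -- `x`. The sign imposed is taken from the current system, because earlier eliminations may
        -- have changed it.
        rw [hφ, hx1, hx2]
        split_ifs <;> simp
      simp [this, hx1]
    · obtain ⟨Λ', hΛ', hΛ1'⟩ :=
        a.1.impose_linear p (if st.net w p ≤ 0 then a.1.σ p else -a.1.σ p)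
      refine ⟨Λ' ∘ₗ Λ, fun j => by rw [hΛ', hΛ]; rfl, ?_⟩
      rw [hs]
      rintro v (rfl | hv)
      · rw [LinearMap.comp_apply, ← hΛ]; exact hΛ1'
      · rw [LinearMap.comp_apply, hΛ1 v hv, map_zero]
    · simp only [List.length_append, List.length_singleton]
      refine Nat.lt_of_le_of_lt hr (Submodule.finrank_lt_finrank_of_lt ?_)
      rw [hs]
      -- `Λ` vanishes on the old span but not at `A p`, so the span grows strictly.
      refine lt_of_le_of_ne (Submodule.span_mono (Set.subset_insert _ _)) fun hc => h0 ?_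
      have hin : st.A p ∈ Submodule.span (ZMod 2) (st.support w t) := by
        rw [hc]; exact Submodule.subset_span (Set.mem_insert _ _)
      have hle : Submodule.span (ZMod 2) (st.support w t) ≤ LinearMap.ker Λ :=
        Submodule.span_le.2 fun v hv => hΛ1 v hv
      exact hle hin
    · intro p' hp'
      rcases List.mem_append.1 hp' with h2 | h2
      · exact hm p' h2
      · rw [List.mem_singleton.1 h2]
        exact ⟨h, fun hc => h0 (by rw [hc, map_zero])⟩

theorem scan_inv (w : Fin m → ℕ) (st : State n m) : ScanInv w st m (st.scan w) :=
  scan_inv_aux w st m le_rfl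

theorem impose_of_pivot {st : State n m} {p : Fin m} {q : Fin n} (g : ℤˣ)
    (h : pivot (st.A p) = some q) : st.impose p g = st.elim p q g := by
  unfold impose
  rw [h]

/-- The imposed sign makes the merged character of equation `p` contribute its coefficient with
positive sign. -/
theorem coeff_impose (w : Fin m → ℕ) (st : State n m) {p : Fin m} (hp : st.A p ≠ 0) :
    (st.impose p (if st.net w p ≤ 0 then -st.σ p else st.σ p)).coeff w 0
      = st.coeff w 0 + |st.net w p| := by
  unfold impose
  split
  · next h => exact (hp (pivot_eq_none h)).elim
  · next q h =>
    rw [coeff_elim w st (pivot_eq_some h), coeff_eq]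
    split_ifs with h1
    · rw [abs_of_nonpos h1]
      rcases Int.units_eq_one_or (st.σ p) with h | h <;> simp [h]
    · rw [abs_of_pos (not_le.1 h1)]
      rcases Int.units_eq_one_or (st.σ p) with h | h <;> simp [h]

theorem level_val (w : Fin m → ℕ) (st : State n m) (d : ℕ) :
    ∃ φ : (Fin n → ℤˣ) → Fin n → ℤˣ, ∀ j x, (st.level w d).val j x = st.val j (φ x) := by
  unfold level
  split
  · obtain ⟨φ, h, _⟩ := (scan_inv w st).val
    exact ⟨φ, h⟩
  · next p _ =>
    obtain ⟨φ, h, _⟩ := st.impose_val p (if st.net w p ≤ 0 then -st.σ p else st.σ p)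
    exact ⟨φ, h⟩

/-- The part of the excess that comes from characters with zero coefficient vanishes. -/
theorem sum_net_eq_zero (w : Fin m → ℕ) (st : State n m) (x : Fin n → ℤˣ) :
    ∑ j, (if st.net w j = 0 then (w j : ℤ) * (st.val j x : ℤˣ) else 0) = 0 := by
  classical
  have h0 : ∀ j, st.net w j = 0 ↔ st.coeff w (st.A j) = 0 := by
    intro j
    rw [net_eq]
    simp
  -- Group by left-hand side: up to sign, the net weight is the coefficient of the common character,
  -- so a group vanishes as a whole or is absent.
  rw [← Finset.sum_fiberwise Finset.univ st.A]
  refine Finset.sum_eq_zero fun v _ => ?_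
  rw [Finset.sum_filter]
  by_cases hv : st.coeff w v = 0
  · have : ∀ j, (if st.A j = v then (if st.net w j = 0 then (w j : ℤ) * (st.val j x : ℤˣ) else 0)
        else 0) = (chi v x : ℤ) * (if st.A j = v then (w j : ℤ) * (st.σ j : ℤˣ) else 0) := by
      intro j
      split_ifs with h1 h2
      · rw [val, h1]; push_cast; ring
      · exact (h2 ((h0 j).2 (by rw [h1]; exact hv))).elim
      · simp
    simp only [this]
    rw [← Finset.mul_sum]
    change _ * st.coeff w v = 0
    rw [hv, mul_zero]
  · refine Finset.sum_eq_zero fun j _ => ?_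
    split_ifs with h1 h2
    · exact (hv (by rw [← h1]; exact (h0 j).1 h2)).elim
    · rfl
    · rfl

/-- If `x` falsifies everything that the scan lists, the scan ends with a constant excess. -/
theorem coeff_scan (w : Fin m → ℕ) (st : State n m) (x : Fin n → ℤˣ)
    (hx : ∀ p ∈ (st.scan w).2, st.val p x = if st.net w p ≤ 0 then 1 else -1) :
    (st.scan w).1.coeff w 0 = st.excess w x := by
  obtain ⟨⟨φ, hφ, hφ1⟩, ⟨Λ, hΛ, hΛ1⟩, -, -⟩ := scan_inv w st
  set W := (st.scan w).1 with hW
  have hconst : ∀ y, W.excess w y = st.excess w x := by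
    intro y
    -- Equations of nonzero net weight have left-hand side `Λ (A j) = 0` and are constant; the
    -- others cancel at the assignment `φ z`. Hence the excess does not depend on `z`, and its mean
    -- is the constant term.
    have h1 : ∀ z, W.excess w z =
        ∑ j, (if st.net w j = 0 then 0 else (w j : ℤ) * (W.σ j : ℤˣ)) := by
      intro z
      have h2 := sum_net_eq_zero w st (φ z)
      have h3 : W.excess w z = ∑ j, (if st.net w j = 0 then (w j : ℤ) * (st.val j (φ z) : ℤˣ)
          else 0) + ∑ j, (if st.net w j = 0 then 0 else (w j : ℤ) * (W.σ j : ℤˣ)) := by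
        rw [← Finset.sum_add_distrib]
        refine Finset.sum_congr rfl fun j _ => ?_
        by_cases hj : st.net w j = 0
        · rw [if_pos hj, if_pos hj, hφ, add_zero]
        · rw [if_neg hj, if_neg hj, zero_add, val, hΛ, hΛ1 _ ⟨j, j.2, hj, rfl⟩, chi_zero, mul_one]
      rw [h3, h2, zero_add]
    rw [h1 y, ← h1 x, excess_of_val hφ, hφ1 x hx]
  have h := W.sum_excess w
  simp only [hconst, Finset.sum_const, Finset.card_univ, Fintype.card_pi, Finset.prod_const,
    Fintype.card_units_int, Fintype.card_fin, nsmul_eq_mul] at h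
  push_cast at h
  exact (mul_left_cancel₀ (by positivity) h).symm

/-- Completeness of the search. The budget `t` covers the gap between the constant term and `K`;
each imposed equation closes at least 1 of it. The extra level performs the final test. -/
theorem exists_run (w : Fin m → ℕ) (K R t : ℕ) (st : State n m) (h0 : 0 ≤ st.coeff w 0)
    (ht : (K : ℤ) ≤ st.coeff w 0 + t) (hx : ∃ x, (K : ℤ) ≤ st.excess w x) :
    ∃ v < (R + 1) ^ (t + 1), st.Run w K R (t + 1) v := by
  induction t generalizing st with
  | zero => exact ⟨0, by positivity, Or.inl (Or.inl (by simpa using ht))⟩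
  | succ t ih =>
    by_cases hg : st.Good w K R
    · exact ⟨0, by positivity, Or.inl hg⟩
    have hlen : (st.scan w).2.length ≤ R := by
      by_contra hc
      exact hg (Or.inr ⟨h0, not_le.1 hc⟩)
    suffices ∃ d ≤ R, 0 ≤ (st.level w d).coeff w 0 ∧
        (K : ℤ) ≤ (st.level w d).coeff w 0 + t ∧ ∃ x, (K : ℤ) ≤ (st.level w d).excess w x by
      obtain ⟨d, hd, h1, h2, h3⟩ := this
      obtain ⟨v, hv, hr⟩ := ih _ h1 h2 h3
      -- The child `d` becomes the leading digit in base `R + 1`; the inductive branch supplies the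
      -- remaining digits.
      refine ⟨(R + 1) ^ (t + 1) * d + v, ?_, Or.inr ?_⟩
      · rw [pow_succ _ (t + 1)]
        calc (R + 1) ^ (t + 1) * d + v < (R + 1) ^ (t + 1) * d + (R + 1) ^ (t + 1) := by omega
          _ = (R + 1) ^ (t + 1) * (d + 1) := by ring
          _ ≤ _ := Nat.mul_le_mul_left _ (by omega)
      · rw [Nat.mul_add_mod, Nat.mod_eq_of_lt hv, Nat.mul_add_div (by positivity),
          Nat.div_eq_of_lt hv]
        exact hr
    obtain ⟨x, hx⟩ := hx
    by_cases hf : ∀ p ∈ (st.scan w).2, st.val p x = if st.net w p ≤ 0 then 1 else -1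
    -- The list length is the first index with no entry, so this digit selects the system with all
    -- listed equations falsified.
    · refine ⟨(st.scan w).2.length, hlen, ?_⟩
      have : st.level w (st.scan w).2.length = (st.scan w).1 := by
        simp [level]
      rw [this]
      have hc := coeff_scan w st x hf
      have hK : (0 : ℤ) ≤ K := by positivity
      refine ⟨by omega, by omega, ?_⟩
      obtain ⟨y, hy⟩ := (st.scan w).1.exists_excess_ge_coeff_zero w
      exact ⟨y, by omega⟩
    -- Some listed equation is not falsified by `x`; branching on it fixes `x`, and its nonzero
    -- integral net weight pays for one level.
    · push Not at hf
      obtain ⟨p, hp, hpx⟩ := hf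
      obtain ⟨d, hd, hdp⟩ := List.getElem_of_mem hp
      refine ⟨d, by omega, ?_⟩
      have hl : st.level w d = st.impose p (if st.net w p ≤ 0 then -st.σ p else st.σ p) := by
        unfold level
        rw [List.getElem?_eq_getElem hd, hdp]
      obtain ⟨hn, hA⟩ := (scan_inv w st).mem p hp
      have hc := coeff_impose w st hA
      have hpos := abs_pos.2 hn
      rw [hl]
      refine ⟨by omega, by push_cast at ht; omega, x, ?_⟩
      obtain ⟨φ, hφ, hφ1⟩ := st.impose_val p (if st.net w p ≤ 0 then -st.σ p else st.σ p)
      rw [excess_of_val hφ, hφ1 x ?_]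
      · exact hx
      · split_ifs at hpx ⊢ with h
        · rw [mul_neg, Int.units_mul_self]
          exact (Int.units_eq_one_or _).resolve_left hpx
        · rw [Int.units_mul_self]
          exact (Int.units_eq_one_or _).resolve_right hpx

/-! ### Systems of large rank -/

theorem char_two_sum_symmDiff {V : Type*} [AddCommGroup V] [Module (ZMod 2) V] [DecidableEq V]
    (S T : Finset V) : ∑ v ∈ symmDiff S T, v = ∑ v ∈ S, v + ∑ v ∈ T, v := by
  have h2 : ∀ v : V, v + v = 0 := fun v => by
    rw [← two_smul (ZMod 2) v, show (2 : ZMod 2) = 0 from rfl, zero_smul]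
  have h1 : symmDiff S T = (S \ T) ∪ (T \ S) := rfl
  rw [h1, Finset.sum_union (Finset.disjoint_left.2 (by simp_all)),
    ← Finset.sum_sdiff (Finset.inter_subset_left (s₁ := S) (s₂ := T)),
    ← Finset.sum_sdiff (Finset.inter_subset_right (s₁ := S) (s₂ := T)),
    Finset.sdiff_inter_self_left, Finset.sdiff_inter_self_right, add_add_add_comm, h2, add_zero]

/-- If the rank of a small set `M` is large, then `M` contains a large subset in which no sum of
two or more elements is in `M ∪ {0}`. -/
theorem exists_sumFree {V : Type*} [AddCommGroup V] [Module (ZMod 2) V] [Finite V] [DecidableEq V]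
    (M : Finset V) (l : ℕ)
    (h : (M.card + 1) ^ l < 2 ^ Module.finrank (ZMod 2) (Submodule.span (ZMod 2) (M : Set V))) :
    ∃ T ⊆ M, l < T.card ∧ ∀ U ⊆ T, U.Nonempty →
      ∑ v ∈ U, v ≠ 0 ∧ (∑ v ∈ U, v ∈ M → U.card = 1) := by
  classical
  have := Fintype.ofFinite V
  set H := Submodule.span (ZMod 2) (M : Set V) with hH
  -- The range of `f` consists of the sums of at most `l` terms from `M`, with `none` as padding. It
  -- has at most `(M.card + 1) ^ l` elements, fewer than the span.
  let f : (Fin l → Option M) → V := fun g => ∑ i, (g i).elim 0 (fun v => (v : V))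
  obtain ⟨z, hzH, hz⟩ : ∃ z ∈ H, z ∉ Set.range f := by
    by_contra! hc
    have h1 : Nat.card H ≤ Nat.card (Fin l → Option M) := by
      have h2 : Nat.card (H : Set V) ≤ Nat.card (Set.range f) :=
        Nat.card_mono (Set.toFinite _) hc
      exact h2.trans (Finite.card_range_le f)
    have h3 : Nat.card H = 2 ^ Module.finrank (ZMod 2) H := by
      rw [Module.natCard_eq_pow_finrank (K := ZMod 2), Nat.card_zmod]
    rw [h3] at h1
    simp at h1
    omega
  have hex : ∃ T : Finset V, T ⊆ M ∧ ∑ v ∈ T, v = z := by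
    obtain ⟨c, -, hc⟩ := Submodule.mem_span_finset.1 hzH
    refine ⟨M.filter fun v => c v ≠ 0, Finset.filter_subset _ _, ?_⟩
    rw [← hc, Finset.sum_filter]
    refine Finset.sum_congr rfl fun v _ => ?_
    rcases zmod_two_cases (c v) with h | h <;> simp [h]
  -- A shortest representation of `z`. If it had at most `l` terms, `z` would lie in the range of
  -- `f`.
  obtain ⟨T, ⟨hTM, hTz⟩, hmin⟩ := exists_minimalFor_of_wellFoundedLT
    (fun T : Finset V => T ⊆ M ∧ ∑ v ∈ T, v = z) Finset.card hex
  have hmin' : ∀ T' : Finset V, T' ⊆ M → ∑ v ∈ T', v = z → T.card ≤ T'.card := by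
    intro T' h1 h2
    by_contra hc
    exact hc (hmin ⟨h1, h2⟩ (by omega))
  refine ⟨T, hTM, ?_, ?_⟩
  · by_contra hc
    push Not at hc
    apply hz
    obtain ⟨e⟩ := Function.Embedding.nonempty_of_card_le (α := T) (β := Fin l) (by simpa using hc)
    refine ⟨fun i => if h : ∃ v, e v = i then some ⟨(h.choose : V), hTM h.choose.2⟩ else none, ?_⟩
    rw [← hTz, ← Finset.sum_coe_sort T]
    change ∑ i, _ = _
    symm
    refine Finset.sum_of_injOn e e.injective.injOn (fun _ _ => Finset.mem_univ _) ?_ ?_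
    · intro i _ hi
      have : ¬ ∃ v, e v = i := by
        rintro ⟨v, rfl⟩
        exact hi ⟨v, by simp⟩
      simp [this]
    · intro v _
      have h1 : ∃ v', e v' = e v := ⟨v, rfl⟩
      have h2 := e.injective h1.choose_spec
      simp only [dif_pos h1, Option.elim_some, h2]
  · intro U hU hne
    have hsum : ∑ v ∈ T \ U, v + ∑ v ∈ U, v = z := by rw [Finset.sum_sdiff hU, hTz]
    have hcard := Finset.card_sdiff_add_card_eq_card hU
    have hUpos := Finset.card_pos.2 hne
    constructor
    · intro h0
      rw [h0, add_zero] at hsum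
      have := hmin' _ (Finset.sdiff_subset.trans hTM) hsum
      omega
    · intro hm
      -- Replace the terms in `U` by their sum. The symmetric difference handles the case that this
      -- sum already occurs in `T \ U`. Minimality then forces `U` to have one element.
      have h1 : ∑ v ∈ symmDiff (T \ U) {∑ v ∈ U, v}, v = z := by
        rw [char_two_sum_symmDiff, Finset.sum_singleton, hsum]
      have h2 : symmDiff (T \ U) {∑ v ∈ U, v} ⊆ (T \ U) ∪ {∑ v ∈ U, v} := symmDiff_le_sup
      have h3 := hmin' _ (h2.trans (Finset.union_subset (Finset.sdiff_subset.trans hTM)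
        (Finset.singleton_subset_iff.2 hm))) h1
      have h4 := (Finset.card_le_card h2).trans (Finset.card_union_le _ _)
      simp only [Finset.card_singleton] at h4
      omega

/-- A Riesz product argument: a nonnegative weight of mean 1 is correlated with the characters in
`T` and with no other nonconstant character of the excess. -/
theorem exists_excess_gt (w : Fin m → ℕ) (st : State n m) (h0 : 0 ≤ st.coeff w 0) (l : ℕ)
    (h : (m + 1) ^ l < 2 ^ (st.scan w).2.length) : ∃ x, (l : ℤ) ≤ st.excess w x := by
  classical
  set M : Finset (Fin n → ZMod 2) := (Finset.univ.filter fun p => st.net w p ≠ 0).image st.A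
    with hM
  have hMs : (M : Set (Fin n → ZMod 2)) = st.support w m := by
    ext v
    simp [hM, support]
  have hMm : M.card ≤ m :=
    Finset.card_image_le.trans ((Finset.card_filter_le _ _).trans (by simp))
  obtain ⟨T, hTM, hl, hT⟩ := exists_sumFree M l (by
    rw [hMs]
    calc (M.card + 1) ^ l ≤ (m + 1) ^ l := Nat.pow_le_pow_left (by omega) _
      _ < _ := h
      _ ≤ _ := Nat.pow_le_pow_right (by norm_num) (scan_inv w st).rank)
  have hMc : ∀ v, st.coeff w v ≠ 0 → v ∈ M := by
    intro v hv
    obtain ⟨j, -, hj⟩ := Finset.exists_ne_zero_of_sum_ne_zero hv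
    have hj' : st.A j = v := by by_contra hc; exact hj (by simp [hc])
    refine Finset.mem_image.2 ⟨j, Finset.mem_filter.2 ⟨Finset.mem_univ _, ?_⟩, hj'⟩
    rw [net_eq, hj']
    simpa using hv
  have hcM : ∀ v ∈ M, st.coeff w v ≠ 0 := by
    intro v hv
    obtain ⟨j, hj, rfl⟩ := Finset.mem_image.1 hv
    have := (Finset.mem_filter.1 hj).2
    rw [net_eq] at this
    simpa using this
  let s : (Fin n → ZMod 2) → ℤˣ := fun v => if st.coeff w v ≤ 0 then -1 else 1
  let G : (Fin n → ℤˣ) → ℤ := fun x => ∏ v ∈ T, (1 + (s v * chi v x : ℤˣ))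
  have hG0 : ∀ x, 0 ≤ G x := fun x => Finset.prod_nonneg fun v _ => by
    rcases Int.units_eq_one_or (s v * chi v x) with h | h <;> simp [h]
  have hG : ∀ x, G x = ∑ U ∈ T.powerset, ((∏ v ∈ U, s v : ℤˣ) : ℤ) * (chi (∑ v ∈ U, v) x : ℤˣ) := by
    intro x
    simp only [G, Finset.prod_one_add, chi_sum]
    refine Finset.sum_congr rfl fun U _ => ?_
    rw [← Units.val_mul, ← Finset.prod_mul_distrib, Units.coe_prod]
  -- No nonempty subset of `T` sums to 0, so only the empty product has nonzero mean.
  have hsum1 : ∑ x, G x = 2 ^ n := by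
    simp only [hG]
    rw [Finset.sum_comm]
    simp only [← Finset.mul_sum, sum_chi]
    rw [Finset.sum_eq_single ∅]
    · simp
    · intro U hU hne
      rw [if_neg (hT U (Finset.mem_powerset.1 hU) (Finset.nonempty_of_ne_empty hne)).1, mul_zero]
    · simp
  -- A subset of two or more elements sums to a vector outside `M`, whose coefficient is 0. What
  -- remains is the empty set and the singletons, with signs turning coefficients into absolute
  -- values.
  have hsum2 : ∑ x, G x * st.excess w x = 2 ^ n * (st.coeff w 0 + ∑ v ∈ T, |st.coeff w v|) := by
    simp only [hG, Finset.sum_mul, mul_assoc]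
    rw [Finset.sum_comm]
    simp only [← Finset.mul_sum, sum_excess_mul_chi]
    rw [← Finset.add_sum_erase _ _ (Finset.empty_mem_powerset T), mul_add, Finset.mul_sum]
    congr 1
    · simp
    · symm
      refine Finset.sum_of_injOn (fun v => {v}) (fun a _ b _ hab => Finset.singleton_injective hab)
        ?_ ?_ ?_
      · intro v hv
        simp only [Finset.coe_erase, Finset.coe_powerset, Set.mem_sdiff, Set.mem_preimage,
          Set.mem_powerset_iff, Set.mem_singleton_iff]
        refine ⟨by simpa using hv, Finset.singleton_ne_empty v⟩
      · intro U hU hnot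
        have hU1 := Finset.mem_erase.1 hU
        obtain ⟨h1, h2⟩ :=
          hT U (Finset.mem_powerset.1 hU1.2) (Finset.nonempty_of_ne_empty hU1.1)
        have : st.coeff w (∑ v ∈ U, v) = 0 := by
          by_contra hc
          obtain ⟨v, rfl⟩ := Finset.card_eq_one.1 (h2 (hMc _ hc))
          exact hnot ⟨v, by simpa using Finset.mem_powerset.1 hU1.2, rfl⟩
        simp [this]
      · intro v hv
        simp only [Finset.prod_singleton, Finset.sum_singleton, s]
        split_ifs with h1
        · rw [abs_of_nonpos h1]; simp
        · rw [abs_of_pos (not_le.1 h1)]; simp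
  have hbig : (T.card : ℤ) ≤ ∑ v ∈ T, |st.coeff w v| := by
    rw [Finset.card_eq_sum_ones, Nat.cast_sum]
    refine Finset.sum_le_sum fun v hv => ?_
    have := abs_pos.2 (hcM v (hTM hv))
    push_cast
    omega
  by_contra! hc
  have h1 : ∑ x, G x * st.excess w x ≤ ∑ x, G x * l :=
    Finset.sum_le_sum fun x _ => mul_le_mul_of_nonneg_left (hc x).le (hG0 x)
  rw [← Finset.sum_mul, hsum1, hsum2] at h1
  have h2 := le_of_mul_le_mul_left h1 (by positivity)
  omega

/-- Soundness for arbitrary branch numbers: both tests yield a large excess at the current node, and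
`level_val` carries it back to the root. -/
theorem excess_of_run (w : Fin m → ℕ) (K R t v : ℕ) (st : State n m)
    (hR : (m + 1) ^ K ≤ 2 ^ R) (h : st.Run w K R t v) : ∃ x, (K : ℤ) ≤ st.excess w x := by
  induction t generalizing v st with
  | zero => exact h.elim
  | succ t ih =>
    rcases h with (h | ⟨h0, h1⟩) | h
    · obtain ⟨x, hx⟩ := st.exists_excess_ge_coeff_zero w
      exact ⟨x, h.trans hx⟩
    · exact st.exists_excess_gt w h0 K
        (hR.trans_lt (Nat.pow_lt_pow_right (by norm_num) h1))
    · obtain ⟨x, hx⟩ := ih _ _ h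
      obtain ⟨φ, hφ⟩ := st.level_val w (v / (R + 1) ^ t)
      exact ⟨φ x, by rwa [← excess_of_val hφ]⟩

end State

/-! ### From the decision problem to the search -/

variable {n m : ℕ}

open Classical in
/-- The state of the search at the root. -/
noncomputable def initial (S : LinSystem n m) : State n m where
  A j i := if i ∈ S.supp j then 1 else 0
  σ := S.rhs

theorem excess_initial (S : LinSystem n m) (x : Fin n → ℤˣ) :
    S.initial.excess S.weight x = 2 * S.satWeight x - S.totalWeight := by
  unfold State.excess satWeight totalWeight
  push_cast
  rw [Finset.mul_sum, ← Finset.sum_sub_distrib]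
  refine Finset.sum_congr rfl fun j _ => ?_
  have : chi (S.initial.A j) x = ∏ i ∈ S.supp j, x i := by
    classical
    rw [chi, ← Finset.prod_subset (Finset.subset_univ (S.supp j))]
    · refine Finset.prod_congr rfl fun i hi => ?_
      simp [initial, hi]
    · intro i _ hi
      simp [initial, hi]
  rw [State.val, this]
  generalize ∏ i ∈ S.supp j, x i = a
  change _ * ((S.rhs j * a : ℤˣ) : ℤ) = _
  rcases Int.units_eq_one_or a with rfl | rfl <;>
    rcases Int.units_eq_one_or (S.rhs j) with h | h <;> simp [h] <;> ring

/-- No left-hand side is the zero vector because every support is nonempty. This supplies the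
initial budget of `2k` levels. -/
theorem coeff_initial (S : LinSystem n m) : S.initial.coeff S.weight 0 = 0 := by
  refine Finset.sum_eq_zero fun j _ => if_neg fun h => ?_
  obtain ⟨i, hi⟩ := S.supp_nonempty j
  have := congrFun h i
  simp [initial, hi] at this

theorem isYes_iff (S : LinSystem n m) (k : ℕ) :
    S.IsYes k ↔ ∃ x, ((2 * k : ℕ) : ℤ) ≤ S.initial.excess S.weight x := by
  have h1 : S.IsYes k ↔ S.totalWeight + 2 * k ≤ 2 * S.sat := by
    unfold IsYes
    rw [← Nat.cast_le (α := ℚ)]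
    push_cast
    constructor <;> intro h <;> linarith
  rw [h1]
  simp only [excess_initial]
  constructor
  · intro h
    obtain ⟨x, -, hx⟩ := Finset.exists_mem_eq_sup' Finset.univ_nonempty S.satWeight
    refine ⟨x, ?_⟩
    have : S.sat = S.satWeight x := hx
    omega
  · rintro ⟨x, hx⟩
    have : S.satWeight x ≤ S.sat := Finset.le_sup' S.satWeight (Finset.mem_univ x)
    omega

theorem isYes_iff_run (S : LinSystem n m) (k R : ℕ) (hR : (m + 1) ^ (2 * k) ≤ 2 ^ R) :
    S.IsYes k ↔ ∃ v < (R + 1) ^ (2 * k + 1), S.initial.Run S.weight (2 * k) R (2 * k + 1) v := by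
  rw [isYes_iff]
  constructor
  · exact State.exists_run _ _ _ _ _ S.coeff_initial.ge (by rw [coeff_initial]; simp)
  · rintro ⟨v, -, hv⟩
    exact State.excess_of_run _ _ _ _ _ _ hR hv

end LinSystem

namespace RAM

/-! ### Reasoning about programs -/

/-- The program `p`, started in `s`, halts within `c` steps in a store that satisfies `Q`. -/
def Ex (p : Prog) (s : Store) (c : ℕ) (Q : Store → Prop) : Prop :=
  ∃ T s', Exec p s T s' ∧ T ≤ c ∧ Q s'

/-- The variables that a program may write. -/
def Prog.wv : Prog → List ℕ
  | .skip => []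
  | .assign x _ => [x]
  | .store _ _ _ => []
  | .seq p q => p.wv ++ q.wv
  | .ite _ p q => p.wv ++ q.wv
  | .while _ p => p.wv

/-- The arrays that a program may write. -/
def Prog.wa : Prog → List ℕ
  | .skip => []
  | .assign _ _ => []
  | .store a _ _ => [a]
  | .seq p q => p.wa ++ q.wa
  | .ite _ p q => p.wa ++ q.wa
  | .while _ p => p.wa

/-- The stores agree, except possibly on the listed variables and arrays. -/
structure Same (lv la : List ℕ) (s s' : Store) : Prop where
  var : ∀ x, x ∉ lv → s'.var x = s.var x
  arr : ∀ a, a ∉ la → s'.arr a = s.arr a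

theorem Same.refl (lv la : List ℕ) (s : Store) : Same lv la s s :=
  ⟨fun _ _ => rfl, fun _ _ => rfl⟩

theorem Same.trans {lv la lv' la' : List ℕ} {s s' s'' : Store} (h : Same lv la s s')
    (h' : Same lv' la' s' s'') : Same (lv ++ lv') (la ++ la') s s'' :=
  ⟨fun x hx => by
    rw [List.mem_append, not_or] at hx
    rw [h'.var x hx.2, h.var x hx.1],
   fun x hx => by
    rw [List.mem_append, not_or] at hx
    rw [h'.arr x hx.2, h.arr x hx.1]⟩

theorem Same.mono {lv la lv' la' : List ℕ} {s s' : Store} (h : Same lv la s s')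
    (hv : lv ⊆ lv') (ha : la ⊆ la') : Same lv' la' s s' :=
  ⟨fun x hx => h.var x fun hc => hx (hv hc), fun x hx => h.arr x fun hc => hx (ha hc)⟩

@[simp] theorem Store.setVar_var (s : Store) (x y : ℕ) (v : ℤ) :
    (s.setVar x v).var y = if y = x then v else s.var y := by
  simp [Store.setVar, Function.update_apply]

@[simp] theorem Store.setVar_arr (s : Store) (x : ℕ) (v : ℤ) : (s.setVar x v).arr = s.arr := rfl

@[simp] theorem Store.setArr_var (s : Store) (a : ℕ) (z v : ℤ) : (s.setArr a z v).var = s.var := rfl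

@[simp] theorem Store.setArr_arr (s : Store) (a b : ℕ) (z y v : ℤ) :
    (s.setArr a z v).arr b y = if b = a ∧ y = z then v else s.arr b y := by
  unfold Store.setArr
  by_cases h : b = a
  · subst h; simp [Function.update_apply]
  · simp [h]

/-- The frame rule. Names of variables and arrays are numerals, so later side conditions about what
a block leaves alone are decidable. -/
theorem Exec.same {p : Prog} {s s' : Store} {T : ℕ} (h : Exec p s T s') :
    Same p.wv p.wa s s' := by
  induction h with
  | skip s => exact Same.refl _ _ _
  | assign x e s => exact ⟨fun y hy => by simp_all [Prog.wv], fun _ _ => rfl⟩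
  | store a e₁ e₂ s =>
    exact ⟨fun _ _ => rfl, fun b hb => by
      funext z
      simp_all [Prog.wa]⟩
  | seq _ _ ih ih' => exact ih.trans ih'
  | ite_true _ _ ih =>
    exact ih.mono (List.subset_append_left _ _) (List.subset_append_left _ _)
  | ite_false _ _ ih =>
    exact ih.mono (List.subset_append_right _ _) (List.subset_append_right _ _)
  | while_true _ _ _ ih ih' =>
    exact (ih.trans ih').mono (by simp [Prog.wv]) (by simp [Prog.wa])
  | while_false _ => exact Same.refl _ _ _

namespace Ex

variable {p q : Prog} {s : Store} {c c' c₁ c₂ : ℕ} {Q Q' : Store → Prop}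

theorem weaken (h : Ex p s c Q) (hc : c ≤ c') : Ex p s c' Q := by
  obtain ⟨T, s', h1, h2, h3⟩ := h
  exact ⟨T, s', h1, h2.trans hc, h3⟩

theorem imp (h : Ex p s c Q) (hQ : ∀ s', Q s' → Q' s') : Ex p s c Q' := by
  obtain ⟨T, s', h1, h2, h3⟩ := h
  exact ⟨T, s', h1, h2, hQ _ h3⟩

theorem frame (h : Ex p s c Q) : Ex p s c fun s' => Q s' ∧ Same p.wv p.wa s s' := by
  obtain ⟨T, s', h1, h2, h3⟩ := h
  exact ⟨T, s', h1, h2, h3, h1.same⟩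

theorem skip (h : Q s) : Ex .skip s 1 Q := ⟨1, s, .skip s, le_rfl, h⟩

theorem assign {x : ℕ} {e : Expr} (h : Q (s.setVar x (e.eval s))) :
    Ex (.assign x e) s (e.cost + 1) Q := ⟨_, _, .assign x e s, le_rfl, h⟩

theorem store {a : ℕ} {e₁ e₂ : Expr} (h : Q (s.setArr a (e₁.eval s) (e₂.eval s))) :
    Ex (.store a e₁ e₂) s (e₁.cost + e₂.cost + 1) Q := ⟨_, _, .store a e₁ e₂ s, le_rfl, h⟩

theorem seq (h : Ex p s c₁ fun s' => Ex q s' c₂ Q) : Ex (.seq p q) s (c₁ + c₂) Q := by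
  obtain ⟨T, s', h1, h2, T', s'', h3, h4, h5⟩ := h
  exact ⟨_, _, .seq h1 h3, Nat.add_le_add h2 h4, h5⟩

/-- The bounds of the two branches are added, not maximized, which keeps cost bounds free of case
distinctions. -/
theorem ite {t : Test} (h₁ : t.Holds s → Ex p s c₁ Q) (h₂ : ¬ t.Holds s → Ex q s c₂ Q) :
    Ex (.ite t p q) s (t.cost + 1 + (c₁ + c₂)) Q := by
  by_cases h : t.Holds s
  · obtain ⟨T, s', h1, h2, h3⟩ := h₁ h
    exact ⟨_, _, .ite_true h h1, by omega, h3⟩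
  · obtain ⟨T, s', h1, h2, h3⟩ := h₂ h
    exact ⟨_, _, .ite_false h h1, by omega, h3⟩

end Ex

/-- `for x in 0 .. b - 1 do body`, where `b` is a variable. -/
def forP (x b : ℕ) (body : Prog) : Prog :=
  .seq (.assign x (.const 0))
    (.while (.not (.le (.var b) (.var x)))
      (.seq body (.assign x (.add (.var x) (.const 1)))))

/-- The invariant is required after the increment of the counter. A round costs 9 beyond the body: 5
for the test and 4 for the increment. The remaining 7 are the initialization and the last, failing
test. -/
theorem Ex.forP {x b : ℕ} {body : Prog} {N c : ℕ} {s : Store} {Q : Store → Prop}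
    (I : ℕ → Store → Prop) (hb : s.var b = N) (hbx : b ≠ x) (hx : x ∉ body.wv)
    (hbw : b ∉ body.wv) (h0 : I 0 (s.setVar x 0))
    (hstep : ∀ (t : Fin N) (s₁ : Store), I t s₁ → s₁.var x = (t : ℕ) →
      Same (x :: body.wv) body.wa s s₁ →
      Ex body s₁ c fun s₂ => I (t + 1) (s₂.setVar x ((t : ℕ) + 1)))
    (hQ : ∀ s', I N s' → Same (x :: body.wv) body.wa s s' → Q s') :
    Ex (forP x b body) s (N * (c + 9) + 7) Q := by
  have main : ∀ (r t : ℕ) (s₁ : Store), t + r = N → I t s₁ → s₁.var x = (t : ℕ) →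
      Same (x :: body.wv) body.wa s s₁ →
      Ex (.while (.not (.le (.var b) (.var x)))
        (.seq body (.assign x (.add (.var x) (.const 1))))) s₁ (r * (c + 9) + 5) Q := by
    intro r
    induction r with
    | zero =>
      intro t s₁ ht hI hv hs
      refine ⟨_, s₁, .while_false ?_, by simp [Test.cost, Expr.cost], hQ s₁ ?_ hs⟩
      · simp only [Test.Holds, Expr.eval, hv, hs.var b (by simp [hbx, hbw]), hb]
        simp only [not_not]
        omega
      · rw [← ht]; exact hI
    | succ r ih =>
      intro t s₁ ht hI hv hs
      obtain ⟨T, s₂, h1, h2, h3⟩ := hstep ⟨t, by omega⟩ s₁ hI hv hs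
      have hs2 := h1.same
      have hv2 : s₂.var x = t := by rw [hs2.var x hx, hv]
      obtain ⟨T', s', h4, h5, h6⟩ := ih (t + 1) (s₂.setVar x ((t : ℕ) + 1)) (by omega) h3
        (by simp)
        ⟨fun y hy => by
          simp only [List.mem_cons, not_or] at hy
          simp [hy.1, hs2.var y hy.2, hs.var y (by simp [hy.1, hy.2])],
         fun a ha => by simp [hs2.arr a ha, hs.arr a ha]⟩
      refine ⟨_, s', .while_true (T' := T') ?_ (.seq h1 (.assign x _ s₂)) ?_, ?_, h6⟩
      · simp only [Test.Holds, Expr.eval, hv, hs.var b (by simp [hbx, hbw]), hb]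
        omega
      · simpa [Expr.eval, hv2] using h4
      · simp only [Test.cost, Expr.cost]
        rw [Nat.succ_mul]
        omega
  obtain ⟨T, s', h1, h2, h3⟩ := main N 0 (s.setVar x 0) (by omega) h0 (by simp)
    ⟨fun y hy => by simp_all, fun a ha => rfl⟩
  exact ⟨_, s', .seq (.assign x _ s) h1, by simp only [Expr.cost]; omega, h3⟩

/-! ### The program -/

notation "xN" => (0 : ℕ)
notation "xM" => (1 : ℕ)
notation "xK" => (2 : ℕ)
notation "xEll" => (3 : ℕ)
notation "xR" => (4 : ℕ)
notation "xB" => (5 : ℕ)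
notation "xAns" => (6 : ℕ)
notation "xV" => (7 : ℕ)
notation "xT" => (8 : ℕ)
notation "xRem" => (9 : ℕ)
notation "xD" => (10 : ℕ)
notation "xP" => (11 : ℕ)
notation "xCnt" => (12 : ℕ)
notation "xPick" => (13 : ℕ)
notation "xPickNet" => (14 : ℕ)
notation "xC" => (15 : ℕ)
notation "xJ" => (16 : ℕ)
notation "xI" => (17 : ℕ)
notation "xQ" => (18 : ℕ)
notation "xG" => (19 : ℕ)
notation "xE" => (20 : ℕ)
notation "xTot" => (21 : ℕ)
notation "xPow" => (22 : ℕ)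
notation "xL" => (23 : ℕ)
notation "xConst" => (24 : ℕ)
notation "xTmp" => (25 : ℕ)

notation "aMat" => (0 : ℕ)
notation "aRhs" => (1 : ℕ)
notation "aWt" => (2 : ℕ)
notation "aBase" => (3 : ℕ)
notation "aBaseSgn" => (4 : ℕ)
notation "aWork" => (5 : ℕ)
notation "aWorkSgn" => (6 : ℕ)
notation "aPow" => (7 : ℕ)
notation "aOff" => (8 : ℕ)
notation "aRow" => (9 : ℕ)

/-- The index of the cell in row `e` and column `f` of a matrix. -/
def cell (e f : Expr) : Expr := .add (.get aOff e) f

/-- Copy row `r` of the matrix `a` to the array `aRow`, and find the last nonzero entry. -/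
def loadRow (a r : ℕ) : Prog :=
  .seq (.assign xQ (.const (-1))) <| forP xI xN <|
    .seq (.store aRow (.var xI) (.get a (cell (.var r) (.var xI)))) <|
    .ite (.eq (.get aRow (.var xI)) (.const 0)) .skip (.assign xQ (.var xI))

/-- Copy a system. -/
def copySys (a₁ b₁ a₂ b₂ : ℕ) : Prog :=
  forP xJ xM <|
    .seq (.store b₂ (.var xJ) (.get b₁ (.var xJ))) <| forP xI xN <|
      .store a₂ (cell (.var xJ) (.var xI)) (.get a₁ (cell (.var xJ) (.var xI)))

/-- Eliminate the variable `xQ` from all equations of a system, by means of the equation with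
the left-hand side `aRow` and the right-hand side `xG`. -/
def elimSys (a b : ℕ) : Prog :=
  forP xJ xM <|
    .ite (.eq (.get a (cell (.var xJ) (.var xQ))) (.const 0)) .skip <|
      .seq (forP xI xN <|
        .ite (.eq (.get aRow (.var xI)) (.const 0)) .skip <|
          .store a (cell (.var xJ) (.var xI))
            (.sub (.const 1) (.get a (cell (.var xJ) (.var xI))))) <|
      .ite (.eq (.var xG) (.const 1)) .skip <|
        .store b (.var xJ) (.sub (.const 0) (.get b (.var xJ)))

/-- Compute the net weight `xC` of equation `r`, whose left-hand side is in `aRow`. -/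
def netWeight (r : ℕ) : Prog :=
  .seq (.assign xC (.const 0)) <| forP xJ xM <|
    .seq (.assign xE (.const 1)) <|
    .seq (forP xI xN <|
      .ite (.eq (.get aBase (cell (.var xJ) (.var xI))) (.get aRow (.var xI))) .skip <|
        .assign xE (.const 0)) <|
    .ite (.eq (.var xE) (.const 0)) .skip <|
      .ite (.eq (.get aBaseSgn (.var xJ)) (.get aBaseSgn (.var r)))
        (.assign xC (.add (.var xC) (.get aWt (.var xJ))))
        (.assign xC (.sub (.var xC) (.get aWt (.var xJ))))

/-- Compute the constant term `xConst` of the excess. -/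
def constTerm : Prog :=
  .seq (.assign xConst (.const 0)) <| forP xJ xM <|
    .seq (loadRow aBase xJ) <|
    .ite (.eq (.var xQ) (.const (-1)))
      (.ite (.eq (.get aBaseSgn (.var xJ)) (.const 1))
        (.assign xConst (.add (.var xConst) (.get aWt (.var xJ))))
        (.assign xConst (.sub (.var xConst) (.get aWt (.var xJ)))))
      .skip

/-- One round of the scan. -/
def scanRound : Prog :=
  .seq (loadRow aBase xP) <|
  .seq (netWeight xP) <|
  .ite (.eq (.var xC) (.const 0)) .skip <|
    .seq (loadRow aWork xP) <|
    .ite (.eq (.var xQ) (.const (-1))) .skip <|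
      .seq (.ite (.eq (.var xCnt) (.var xD))
        (.seq (.assign xPick (.var xP)) (.assign xPickNet (.var xC))) .skip) <|
      .seq (.assign xCnt (.add (.var xCnt) (.const 1))) <|
      .seq (.ite (.le (.var xC) (.const 0))
        (.assign xG (.get aWorkSgn (.var xP)))
        (.assign xG (.sub (.const 0) (.get aWorkSgn (.var xP))))) <|
      elimSys aWork aWorkSgn

/-- The scan of the base system. -/
def scanSys : Prog :=
  .seq (copySys aBase aBaseSgn aWork aWorkSgn) <|
  .seq (.assign xCnt (.const 0)) <|
  .seq (.assign xPick (.const (-1))) <|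
  forP xP xM scanRound

/-- One level of the search: test the base system and make one branching step. -/
def levelP : Prog :=
  .seq constTerm <|
  .seq scanSys <|
  .seq (.ite (.le (.add (.var xK) (.var xK)) (.var xConst)) (.assign xAns (.const 1)) .skip) <|
  .seq (.ite (.and (.le (.const 0) (.var xConst)) (.not (.le (.var xCnt) (.var xR))))
    (.assign xAns (.const 1)) .skip) <|
  .ite (.eq (.var xPick) (.const (-1)))
    (copySys aWork aWorkSgn aBase aBaseSgn) <|
    .seq (loadRow aBase xPick) <|
    .seq (.ite (.le (.var xPickNet) (.const 0))
      (.assign xG (.sub (.const 0) (.get aBaseSgn (.var xPick))))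
      (.assign xG (.get aBaseSgn (.var xPick)))) <|
    elimSys aBase aBaseSgn

/-- Divide `xRem` by the power of `xB` that belongs to the level `xT`. -/
def digit : Prog :=
  .seq (.assign xTmp (.get aPow (.sub (.sub (.var xEll) (.const 1)) (.var xT)))) <|
  .seq (.assign xD (.const 0)) <|
  forP xI xB <|
    .ite (.le (.var xTmp) (.var xRem))
      (.seq (.assign xRem (.sub (.var xRem) (.var xTmp)))
        (.assign xD (.add (.var xD) (.const 1))))
      .skip

/-- Follow the branch with number `xV`. -/
def branch : Prog :=
  .seq (copySys aMat aRhs aBase aBaseSgn) <|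
  .seq (.assign xRem (.var xV)) <|
  forP xT xEll (.seq digit levelP)

/-- Compute the row offsets. -/
def offsets : Prog :=
  .seq (.assign xTmp (.const 0)) <| forP xJ xM <|
    .seq (.store aOff (.var xJ) (.var xTmp)) (.assign xTmp (.add (.var xTmp) (.var xN)))

/-- Compute the least `xL` with `m + 1 ≤ 2 ^ xL`. -/
def logM : Prog :=
  .seq (.assign xL (.const 0)) <|
  .seq (.assign xPow (.const 1)) <| forP xJ xM <|
    .ite (.le (.var xPow) (.var xM))
      (.seq (.assign xPow (.add (.var xPow) (.var xPow)))
        (.assign xL (.add (.var xL) (.const 1))))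
      .skip

/-- Compute `xEll`, `xR` and `xB`. -/
def bounds : Prog :=
  .seq (.assign xEll (.add (.add (.var xK) (.var xK)) (.const 1))) <|
  .seq (.assign xR (.const 0)) <|
  .seq (forP xJ xL (.assign xR (.add (.var xR) (.var xEll)))) <|
  .assign xB (.add (.var xR) (.const 1))

/-- Compute the powers of `xB`. -/
def powers : Prog :=
  .seq (.store aPow (.const 0) (.const 1)) <|
  forP xJ xEll <|
    .seq (.assign xTmp (.const 0)) <|
    .seq (forP xI xB (.assign xTmp (.add (.var xTmp) (.get aPow (.var xJ))))) <|
    .store aPow (.add (.var xJ) (.const 1)) (.var xTmp)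

/-- The complete algorithm. -/
def solver : Prog :=
  .seq offsets <| .seq logM <| .seq bounds <| .seq powers <|
  .seq (.assign xTot (.get aPow (.var xEll))) <|
  .seq (.assign xAns (.const 0)) <|
  .seq (forP xV xTot branch) <|
  .assign xN (.var xAns)

/-! ### Correctness of the building blocks -/

/-- The integer that represents an element of `ZMod 2`. -/
def bit (a : ZMod 2) : ℤ := if a = 0 then 0 else 1

@[simp] theorem bit_eq_zero {a : ZMod 2} : bit a = 0 ↔ a = 0 := by
  unfold bit; split_ifs with h <;> simp [h]

theorem bit_inj {a b : ZMod 2} : bit a = bit b ↔ a = b := by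
  rcases LinSystem.zmod_two_cases a with rfl | rfl <;>
    rcases LinSystem.zmod_two_cases b with rfl | rfl <;> simp [bit]

theorem bit_add_one (a : ZMod 2) : bit (a + 1) = 1 - bit a := by
  rcases LinSystem.zmod_two_cases a with rfl | rfl
  · simp [bit]
  · simp [bit, show (1 + 1 : ZMod 2) = 0 from rfl]

/-- The integer that represents an optional index. -/
def enc {N : ℕ} (o : Option (Fin N)) : ℤ := o.elim (-1) fun i => (i : ℕ)

theorem enc_eq_neg_one {N : ℕ} {o : Option (Fin N)} : enc o = -1 ↔ o = none := by
  cases o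
  · simp [enc]
  · simp [enc]

variable {n m : ℕ}

/-- The matrix `A` is stored in the array `a`. -/
def MatAt (s : Store) (a : ℕ) (A : Fin m → Fin n → ZMod 2) : Prop :=
  ∀ (j : Fin m) (i : Fin n), s.arr a (((j : ℕ) : ℤ) * n + ((i : ℕ) : ℤ)) = bit (A j i)

/-- The signs `σ` are stored in the array `b`. -/
def SgnAt (s : Store) (b : ℕ) (σ : Fin m → ℤˣ) : Prop :=
  ∀ j : Fin m, s.arr b ((j : ℕ) : ℤ) = (σ j : ℤ)

/-- The system `st` is stored in the arrays `a` and `b`. -/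
def SysAt (s : Store) (a b : ℕ) (st : LinSystem.State n m) : Prop :=
  MatAt s a st.A ∧ SgnAt s b st.σ

/-- The size of the system, the weights, and the row offsets are stored as they should be. -/
structure Env (n : ℕ) {m : ℕ} (w : Fin m → ℕ) (s : Store) : Prop where
  numVars : s.var xN = n
  numEqs : s.var xM = m
  weight : ∀ j : Fin m, s.arr aWt ((j : ℕ) : ℤ) = w j
  off : ∀ j : Fin m, s.arr aOff ((j : ℕ) : ℤ) = ((j : ℕ) : ℤ) * n

theorem Env.of_same {w : Fin m → ℕ} {s s' : Store} {lv la : List ℕ} (h : Env n w s)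
    (hs : Same lv la s s') (hl : xN ∉ lv ∧ xM ∉ lv ∧ aWt ∉ la ∧ aOff ∉ la) :
    Env n w s' := by
  obtain ⟨h0, h1, h2, h8⟩ := hl
  exact ⟨by rw [hs.var _ h0, h.numVars], by rw [hs.var _ h1, h.numEqs],
    fun j => by rw [hs.arr _ h2, h.weight], fun j => by rw [hs.arr _ h8, h.off]⟩

theorem MatAt.cell {w : Fin m → ℕ} {s : Store} {A : Fin m → Fin n → ZMod 2} {a : ℕ}
    (h : MatAt s a A) (hE : Env n w s) (j : Fin m) (i : Fin n) :
    s.arr a (s.arr aOff ((j : ℕ) : ℤ) + ((i : ℕ) : ℤ)) = bit (A j i) := by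
  rw [hE.off, h]

theorem MatAt.of_same {A : Fin m → Fin n → ZMod 2} {s s' : Store} {lv la : List ℕ} {a : ℕ}
    (h : MatAt s a A) (hs : Same lv la s s') (ha : a ∉ la) : MatAt s' a A :=
  fun j i => by rw [hs.arr _ ha, h j i]

theorem SysAt.of_same {st : LinSystem.State n m} {s s' : Store} {lv la : List ℕ} {a b : ℕ}
    (h : SysAt s a b st) (hs : Same lv la s s') (hab : a ∉ la ∧ b ∉ la) : SysAt s' a b st :=
  ⟨h.1.of_same hs hab.1, fun j => by rw [hs.arr _ hab.2, h.2 j]⟩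

theorem Same.setVar (s : Store) (x : ℕ) (v : ℤ) : Same [x] [] s (s.setVar x v) :=
  ⟨fun y hy => by simp_all, fun _ _ => rfl⟩

/-- Distinct matrix entries occupy distinct cells, so a write changes one entry only. -/
theorem cell_inj {j j' : ℕ} {i i' : ℕ} (hi : i < n) (hi' : i' < n) :
    (j : ℤ) * n + i = (j' : ℤ) * n + i' ↔ j = j' ∧ i = i' := by
  constructor
  · intro h
    have h1 : j * n + i = j' * n + i' := by exact_mod_cast h
    have h2 : j = j' := by
      have := congrArg (· / n) h1
      simpa [Nat.mul_comm _ n, Nat.mul_add_div (by omega : n > 0), Nat.div_eq_of_lt hi,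
        Nat.div_eq_of_lt hi'] using this
    subst h2
    omega
  · rintro ⟨rfl, rfl⟩; rfl

theorem write_cell (s : Store) (a : ℕ) (j j' : Fin m) (i i' : Fin n) (v : ℤ) :
    (s.setArr a (((j : ℕ) : ℤ) * n + ((i : ℕ) : ℤ)) v).arr a
      (((j' : ℕ) : ℤ) * n + ((i' : ℕ) : ℤ)) = if j' = j ∧ i' = i then v
        else s.arr a (((j' : ℕ) : ℤ) * n + ((i' : ℕ) : ℤ)) := by
  simp only [Store.setArr_arr, cell_inj i'.2 i.2, Fin.ext_iff, true_and]

theorem sum_lt_succ {N : ℕ} (g : Fin N → ℤ) (t : Fin N) :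
    ∑ j : Fin N, (if (j : ℕ) < t + 1 then g j else 0)
      = ∑ j : Fin N, (if (j : ℕ) < t then g j else 0) + g t := by
  have : ∀ j : Fin N, (if (j : ℕ) < t + 1 then g j else 0)
      = (if (j : ℕ) < t then g j else 0) + if j = t then g j else 0 := by
    intro j
    rcases lt_trichotomy (j : ℕ) t with h | h | h
    · simp [h, Nat.lt_succ_of_lt h, Fin.ext_iff, h.ne]
    · simp [Fin.ext h]
    · simp [not_lt.2 h.le, Fin.ext_iff, h.ne', Nat.not_lt.2 (Nat.succ_le_of_lt h)]
  simp only [this, Finset.sum_add_distrib, Finset.sum_ite_eq', Finset.mem_univ, if_true]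

theorem sum_lt_all {N : ℕ} (g : Fin N → ℤ) :
    ∑ j : Fin N, (if (j : ℕ) < N then g j else 0) = ∑ j, g j := by
  simp

theorem forall_lt_succ_iff {N : ℕ} {P : Fin N → Prop} (t : Fin N) :
    (∀ i : Fin N, (i : ℕ) < t + 1 → P i) ↔ (∀ i : Fin N, (i : ℕ) < t → P i) ∧ P t := by
  constructor
  · exact fun h => ⟨fun i hi => h i (by omega), h t (by omega)⟩
  · rintro ⟨h1, h2⟩ i hi
    rcases Nat.lt_succ_iff_lt_or_eq.1 hi with h | h
    · exact h1 i h
    · rw [Fin.ext h]; exact h2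

theorem Ex.withSame {p : Prog} {s : Store} {c : ℕ} {Q : Store → Prop} {lv la : List ℕ}
    (h : Ex p s c Q) (hv : p.wv ⊆ lv) (ha : p.wa ⊆ la) :
    Ex p s c fun s' => Q s' ∧ Same lv la s s' :=
  h.frame.imp fun _ h => ⟨h.1, h.2.mono hv ha⟩

theorem loadRow_spec {w : Fin m → ℕ} {s : Store} {a r : ℕ} {A : Fin m → Fin n → ZMod 2}
    (j : Fin m) (hE : Env n w s) (hA : MatAt s a A) (hr : s.var r = ((j : ℕ) : ℤ)) (ha : a ≠ aRow)
    (hrI : r ≠ xI) (hrQ : r ≠ xQ) :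
    Ex (loadRow a r) s (n * 100 + 100) fun s' =>
      (s'.var xQ = enc (LinSystem.pivot (A j)) ∧
        ∀ i : Fin n, s'.arr aRow ((i : ℕ) : ℤ) = bit (A j i)) ∧
      Same [xQ, xI] [aRow] s s' := by
  refine Ex.withSame ?_ (by simp [loadRow, forP, Prog.wv]) (by simp [loadRow, forP, Prog.wa])
  apply Ex.weaken
  · apply Ex.seq
    apply Ex.assign
    -- The loop is the iteration that defines `pivot`, so the invariant is its partial value, with
    -- -1 for `none`.
    apply Ex.forP (N := n) (fun t s₁ =>
      s₁.var xQ = enc (LinSystem.iter (fun i o => if A j i = 0 then o else some i) none t) ∧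
      ∀ i : Fin n, (i : ℕ) < t → s₁.arr aRow ((i : ℕ) : ℤ) = bit (A j i))
    · simp [hE.numVars]
    · decide
    · simp [Prog.wv]
    · simp [Prog.wv]
    · simp [Expr.eval, LinSystem.iter, enc]
    · intro t s₁ hI ht hs
      have hs := (Same.setVar s _ _).trans hs
      have hr1 : s₁.var r = ((j : ℕ) : ℤ) := by rw [hs.var r (by simp [Prog.wv, hrI, hrQ]), hr]
      have hcell := (hA.of_same hs (by simp [Prog.wa, ha])).cell
        (hE.of_same hs (by simp [Prog.wv, Prog.wa])) j t
      apply Ex.seq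
      apply Ex.store
      apply Ex.ite <;> intro h
      · apply Ex.skip
        simp [Test.Holds, Expr.eval, cell, hr1, ht, hcell] at h
        refine ⟨?_, ?_⟩
        · simp [LinSystem.iter_succ, h, hI.1]
        · rw [forall_lt_succ_iff]
          refine ⟨fun i hi => ?_, ?_⟩
          · simp [Expr.eval, ht, hI.2 i hi, hi.ne]
          · simp [Expr.eval, cell, ht, hr1, hcell]
      · apply Ex.assign
        simp [Test.Holds, Expr.eval, cell, hr1, ht, hcell] at h
        refine ⟨?_, ?_⟩
        · simp [LinSystem.iter_succ, h, enc, ht, Expr.eval]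
        · rw [forall_lt_succ_iff]
          refine ⟨fun i hi => ?_, ?_⟩
          · simp [Expr.eval, ht, hI.2 i hi, hi.ne]
          · simp [Expr.eval, cell, ht, hr1, hcell]
    · intro s' h _
      exact ⟨h.1, fun i => h.2 i i.2⟩
  · simp only [Expr.cost, Test.cost, cell]; omega

theorem copySys_spec {w : Fin m → ℕ} {s : Store} {a₁ b₁ a₂ b₂ : ℕ} {st : LinSystem.State n m}
    (hE : Env n w s) (h : SysAt s a₁ b₁ st) (h₁ : a₂ ≠ a₁) (h₂ : a₂ ≠ b₁) (h₃ : b₂ ≠ a₁)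
    (h₄ : b₂ ≠ b₁) (h₅ : a₂ ≠ b₂) (h₆ : a₂ ≠ aOff) (h₇ : b₂ ≠ aOff) (h₈ : a₂ ≠ aWt)
    (h₉ : b₂ ≠ aWt) :
    Ex (copySys a₁ b₁ a₂ b₂) s (m * (n * 100 + 100) + 100) fun s' =>
      SysAt s' a₂ b₂ st ∧ Same [xJ, xI] [a₂, b₂] s s' := by
  refine Ex.withSame ?_ (by simp [copySys, forP, Prog.wv]) (by simp [copySys, forP, Prog.wa])
  apply Ex.weaken
  · apply Ex.forP (N := m) (fun t s₁ => ∀ j : Fin m, (j : ℕ) < t →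
      (∀ i : Fin n, s₁.arr a₂ (((j : ℕ) : ℤ) * n + ((i : ℕ) : ℤ)) = bit (st.A j i)) ∧
      s₁.arr b₂ ((j : ℕ) : ℤ) = (st.σ j : ℤ))
    · simp [hE.numEqs]
    · decide
    · simp [Prog.wv, forP]
    · simp [Prog.wv, forP]
    · simp
    · intro t s₁ hI ht hs
      have hE1 := hE.of_same hs (by simp [Prog.wv, Prog.wa, forP, h₆.symm, h₇.symm, h₈.symm, h₉.symm])
      have hS1 := h.of_same hs (by simp [Prog.wa, forP, h₁.symm, h₂.symm, h₃.symm, h₄.symm])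
      apply Ex.seq
      apply Ex.store
      apply Ex.forP (N := n) (fun u s₂ => (∀ j : Fin m, (j : ℕ) < t →
        ∀ i : Fin n, s₂.arr a₂ (((j : ℕ) : ℤ) * n + ((i : ℕ) : ℤ)) = bit (st.A j i)) ∧
        ∀ i : Fin n, (i : ℕ) < u → s₂.arr a₂ (((t : ℕ) : ℤ) * n + ((i : ℕ) : ℤ)) = bit (st.A t i))
      · simp [hE1.numVars]
      · decide
      · simp [Prog.wv]
      · simp [Prog.wv]
      · simp only [Store.setVar_arr, Store.setArr_arr, h₅, false_and, if_false]
        exact ⟨fun j hj => (hI j hj).1, fun i hi => (Nat.not_lt_zero _ hi).elim⟩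
      · intro u s₂ hI2 hu hs2
        have ht2 : s₂.var xJ = ((t : ℕ) : ℤ) := by
          rw [hs2.var _ (by simp [Prog.wv])]; simp [ht]
        have hoff : s₂.arr aOff ((t : ℕ) : ℤ) = ((t : ℕ) : ℤ) * n := by
          rw [hs2.arr _ (by simp [Prog.wa, h₆.symm])]; simp [h₇.symm, hE1.off]
        have hval : s₂.arr a₁ (((t : ℕ) : ℤ) * n + ((u : ℕ) : ℤ)) = bit (st.A t u) := by
          rw [hs2.arr _ (by simp [Prog.wa, h₁.symm])]; simp [h₃.symm, hS1.1 t u]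
        apply Ex.store
        simp only [Expr.eval, cell, ht2, hu, hoff, hval, Store.setVar_arr, write_cell]
        refine ⟨fun j hj i => ?_, ?_⟩
        · have : j ≠ t := fun hc => hj.ne (congrArg Fin.val hc)
          simp [this, hI2.1 j hj i]
        · rw [forall_lt_succ_iff]
          refine ⟨fun i hi => ?_, by simp⟩
          have : i ≠ u := fun hc => hi.ne (congrArg Fin.val hc)
          simp [this, hI2.2 i hi]
      · intro s' h' hs'
        rw [forall_lt_succ_iff]
        have hb : ∀ j : Fin m, s'.arr b₂ ((j : ℕ) : ℤ) =
            if j = t then (st.σ t : ℤ) else s₁.arr b₂ ((j : ℕ) : ℤ) := by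
          intro j
          rw [hs'.arr _ (by simp [Prog.wa, h₅.symm])]
          simp [Expr.eval, ht, hS1.2 t, Fin.ext_iff]
        refine ⟨fun j hj => ⟨h'.1 j hj, ?_⟩, fun i => h'.2 i i.2, ?_⟩
        · have : j ≠ t := fun hc => hj.ne (congrArg Fin.val hc)
          simp [hb, this, (hI j hj).2]
        · simp [hb]
    · intro s' h' _
      exact ⟨fun j i => (h' j j.2).1 i, fun j => (h' j j.2).2⟩
  · simp only [Expr.cost, cell]
    gcongr m * ?_ + ?_ <;> omega

/-- Adding over `ZMod 2` is flipping the bits where `aRow` is nonzero. The separate copy of row `p`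
is essential, since row `p` itself is cleared during the loop. -/
theorem elimSys_spec {w : Fin m → ℕ} {s : Store} {a b : ℕ} {st : LinSystem.State n m}
    (p : Fin m) (q : Fin n) (g : ℤˣ) (hE : Env n w s) (h : SysAt s a b st)
    (hrow : ∀ i : Fin n, s.arr aRow ((i : ℕ) : ℤ) = bit (st.A p i))
    (hq : s.var xQ = ((q : ℕ) : ℤ)) (hg : s.var xG = (g : ℤ)) (hab : a ≠ b) (ha : a ≠ aOff)
    (hb : b ≠ aOff) (ha' : a ≠ aRow) (hb' : b ≠ aRow) (ha'' : a ≠ aWt) (hb'' : b ≠ aWt) :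
    Ex (elimSys a b) s (m * (n * 100 + 100) + 100) fun s' =>
      SysAt s' a b (st.elim p q g) ∧ Same [xJ, xI] [a, b] s s' := by
  refine Ex.withSame ?_ (by simp [elimSys, forP, Prog.wv]) (by simp [elimSys, forP, Prog.wa])
  apply Ex.weaken
  · apply Ex.forP (N := m) (fun t s₁ => ∀ j : Fin m,
      (∀ i : Fin n, s₁.arr a (((j : ℕ) : ℤ) * n + ((i : ℕ) : ℤ)) =
        bit (if (j : ℕ) < t then (st.elim p q g).A j i else st.A j i)) ∧
      s₁.arr b ((j : ℕ) : ℤ) = ((if (j : ℕ) < t then (st.elim p q g).σ j else st.σ j : ℤˣ) : ℤ))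
    · simp [hE.numEqs]
    · decide
    · simp [Prog.wv, forP]
    · simp [Prog.wv, forP]
    · simpa using fun j => ⟨h.1 j, h.2 j⟩
    · intro t s₁ hI ht hs
      have hE1 := hE.of_same hs (by simp [Prog.wv, Prog.wa, forP, ha.symm, hb.symm, ha''.symm, hb''.symm])
      have hq1 : s₁.var xQ = ((q : ℕ) : ℤ) := by rw [hs.var _ (by simp [Prog.wv, forP]), hq]
      have hg1 : s₁.var xG = (g : ℤ) := by rw [hs.var _ (by simp [Prog.wv, forP]), hg]
      have hrow1 : ∀ i : Fin n, s₁.arr aRow ((i : ℕ) : ℤ) = bit (st.A p i) := by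
        intro i; rw [hs.arr _ (by simp [Prog.wa, forP, ha'.symm, hb'.symm]), hrow]
      have hlt : ∀ j : Fin m, j ≠ t → ((j : ℕ) < t + 1 ↔ (j : ℕ) < t) := by
        intro j hj
        have : (j : ℕ) ≠ t := fun hc => hj (Fin.ext hc)
        omega
      apply Ex.ite <;> intro htest
      · apply Ex.skip
        simp only [Test.Holds, Expr.eval, cell, ht, hE1.off, hq1, (hI t).1 q] at htest
        simp only [lt_irrefl, if_false, bit_eq_zero] at htest
        intro j
        by_cases hj : j = t
        · subst hj
          simpa [LinSystem.State.elim, htest] using hI j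
        · simpa [hlt j hj] using hI j
      · simp only [Test.Holds, Expr.eval, cell, ht, hE1.off, hq1, (hI t).1 q] at htest
        simp only [lt_irrefl, if_false, bit_eq_zero] at htest
        apply Ex.seq
        -- Inside row `t` the first `u` entries are new and the others old. The decision to change
        -- the row was made beforehand, so overwriting column `q` does no harm.
        apply Ex.forP (N := n) (fun u s₂ => (∀ j : Fin m, j ≠ t →
          ∀ i : Fin n, s₂.arr a (((j : ℕ) : ℤ) * n + ((i : ℕ) : ℤ)) =
            s₁.arr a (((j : ℕ) : ℤ) * n + ((i : ℕ) : ℤ))) ∧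
          ∀ i : Fin n, s₂.arr a (((t : ℕ) : ℤ) * n + ((i : ℕ) : ℤ)) =
            bit (if (i : ℕ) < u then st.A t i + st.A p i else st.A t i))
        · simp [hE1.numVars]
        · decide
        · simp [Prog.wv]
        · simp [Prog.wv]
        · simp [(hI t).1]
        · intro u s₂ hI2 hu hs2
          have ht2 : s₂.var xJ = ((t : ℕ) : ℤ) := by
            rw [hs2.var _ (by simp [Prog.wv]), ht]
          have hoff : s₂.arr aOff ((t : ℕ) : ℤ) = ((t : ℕ) : ℤ) * n := by
            rw [hs2.arr _ (by simp [Prog.wa, ha.symm]), hE1.off]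
          have hrow2 : s₂.arr aRow ((u : ℕ) : ℤ) = bit (st.A p u) := by
            rw [hs2.arr _ (by simp [Prog.wa, ha'.symm]), hrow1]
          have hlt2 : ∀ i : Fin n, i ≠ u → ((i : ℕ) < u + 1 ↔ (i : ℕ) < u) := by
            intro i hi
            have : (i : ℕ) ≠ u := fun hc => hi (Fin.ext hc)
            omega
          apply Ex.ite <;> intro htest2
          · apply Ex.skip
            simp only [Test.Holds, Expr.eval, hu, hrow2, bit_eq_zero] at htest2
            refine ⟨hI2.1, fun i => ?_⟩
            by_cases hi : i = u
            · subst hi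
              simpa [htest2] using hI2.2 i
            · simpa [hlt2 i hi] using hI2.2 i
          · apply Ex.store
            simp only [Test.Holds, Expr.eval, hu, hrow2, bit_eq_zero] at htest2
            simp only [Expr.eval, cell, ht2, hu, hoff, Store.setVar_arr, write_cell]
            refine ⟨fun j hj i => ?_, fun i => ?_⟩
            · simp [hj, hI2.1 j hj i]
            · by_cases hi : i = u
              · subst hi
                simp [hI2.2 i, (LinSystem.zmod_two_cases _).resolve_left htest2, bit_add_one]
              · simpa [hi, hlt2 i hi] using hI2.2 i
        · intro s' h' hs'
          have hgs : s'.var xG = (g : ℤ) := by rw [hs'.var _ (by simp [Prog.wv]), hg1]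
          have hts : s'.var xJ = ((t : ℕ) : ℤ) := by rw [hs'.var _ (by simp [Prog.wv]), ht]
          have hbs : s'.arr b = s₁.arr b := hs'.arr _ (by simp [Prog.wa, hab.symm])
          apply Ex.ite <;> intro htest2
          · apply Ex.skip
            simp only [Test.Holds, Expr.eval, hgs] at htest2
            have hg' : g = 1 := Units.ext htest2
            intro j
            by_cases hj : j = t
            · subst hj
              have h1 := h'.2
              have h2 := (hI j).2
              simp only [Fin.is_lt, if_true] at h1
              simp only [lt_irrefl, if_false] at h2
              simp [LinSystem.State.elim, htest, h1, hbs, h2, hg']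
            · simpa [hlt j hj, h'.1 j hj, hbs] using hI j
          · apply Ex.store
            simp only [Test.Holds, Expr.eval, hgs] at htest2
            have hg' : g = -1 := (Int.units_eq_one_or g).resolve_left fun hc => htest2 (by simp [hc])
            intro j
            by_cases hj : j = t
            · subst hj
              have h1 := h'.2
              have h2 := (hI j).2
              simp only [Fin.is_lt, if_true] at h1
              simp only [lt_irrefl, if_false] at h2
              simp [LinSystem.State.elim, htest, h1, hbs, h2, hg', hab, Expr.eval, hts]
            · have hj' : (j : ℕ) ≠ t := fun hc => hj (Fin.ext hc)
              simpa [hlt j hj, h'.1 j hj, hbs, hab, Expr.eval, hts, hj'] using hI j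
    · intro s' h' _
      exact ⟨fun j i => by simpa using (h' j).1 i, fun j => by simpa using (h' j).2⟩
  · simp only [Expr.cost, Test.cost, cell]
    gcongr m * ?_ + ?_ <;> omega

theorem netWeight_spec {w : Fin m → ℕ} {s : Store} {r : ℕ} {st : LinSystem.State n m}
    (p : Fin m) (hE : Env n w s) (h : SysAt s aBase aBaseSgn st)
    (hr : s.var r = ((p : ℕ) : ℤ)) (hr' : r ∉ [xC, xJ, xE, xI])
    (hrow : ∀ i : Fin n, s.arr aRow ((i : ℕ) : ℤ) = bit (st.A p i)) :
    Ex (netWeight r) s (m * (n * 100 + 100) + 100) fun s' =>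
      s'.var xC = st.net w p ∧ Same [xC, xJ, xE, xI] [] s s' := by
  refine Ex.withSame ?_ (by simp [netWeight, forP, Prog.wv]) (by simp [netWeight, forP, Prog.wa])
  simp only [List.mem_cons, List.not_mem_nil, or_false, not_or] at hr'
  apply Ex.weaken
  · apply Ex.seq
    apply Ex.assign
    apply Ex.forP (N := m) (fun t s₁ => s₁.var xC = ∑ j : Fin m, if (j : ℕ) < t then
      (if st.A j = st.A p then (if st.σ j = st.σ p then (w j : ℤ) else -w j) else 0) else 0)
    · simp [hE.numEqs]
    · decide
    · simp [Prog.wv, forP]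
    · simp [Prog.wv, forP]
    · simp [Expr.eval]
    · intro t s₁ hI ht hs
      have hs := (Same.setVar s _ _).trans hs
      have hE1 := hE.of_same hs (by simp [Prog.wv, Prog.wa, forP])
      have hS1 := h.of_same hs (by simp [Prog.wa, forP])
      have hr1 : s₁.var r = ((p : ℕ) : ℤ) := by rw [hs.var r (by simp [Prog.wv, forP, hr']), hr]
      have hrow1 : ∀ i : Fin n, s₁.arr aRow ((i : ℕ) : ℤ) = bit (st.A p i) := by
        intro i; rw [hs.arr _ (by simp [Prog.wa, forP]), hrow]
      apply Ex.seq
      apply Ex.assign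
      apply Ex.seq
      -- The flag `xE` stays 1 while the two rows agree, and once it is 0 they are known to differ.
      apply Ex.forP (N := n) (fun u s₂ =>
        (s₂.var xE = 1 ∧ ∀ i : Fin n, (i : ℕ) < u → st.A t i = st.A p i) ∨
          (s₂.var xE = 0 ∧ st.A t ≠ st.A p))
      · simp [hE1.numVars]
      · decide
      · simp [Prog.wv]
      · simp [Prog.wv]
      · left; simp [Expr.eval]
      · intro u s₂ hI2 hu hs2
        have hs2 := (Same.setVar s₁ _ _).trans hs2
        have ht2 : s₂.var xJ = ((t : ℕ) : ℤ) := by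
          rw [hs2.var _ (by simp [Prog.wv]), ht]
        have hc := (hS1.1.of_same hs2 (by simp [Prog.wa])).cell
          (hE1.of_same hs2 (by simp [Prog.wa, Prog.wv])) t u
        have hrow2 : s₂.arr aRow ((u : ℕ) : ℤ) = bit (st.A p u) := by
          rw [hs2.arr _ (by simp [Prog.wa]), hrow1]
        apply Ex.ite <;> intro htest <;>
          simp only [Test.Holds, Expr.eval, cell, ht2, hu, hc, hrow2, bit_inj] at htest
        · apply Ex.skip
          rcases hI2 with ⟨h1, h2⟩ | h1
          · left
            rw [forall_lt_succ_iff]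
            exact ⟨by simpa using h1, h2, htest⟩
          · right; simpa using h1
        · apply Ex.assign
          right
          exact ⟨by simp [Expr.eval], fun hc => htest (congrFun hc u)⟩
      · intro s' h' hs'
        have hs' := (Same.setVar s₁ _ _).trans hs'
        have ht2 : s'.var xJ = ((t : ℕ) : ℤ) := by
          rw [hs'.var _ (by simp [Prog.wv]), ht]
        have hC2 : s'.var xC = s₁.var xC := by
          rw [hs'.var _ (by simp [Prog.wv])]
        have hr2 : s'.var r = ((p : ℕ) : ℤ) := by
          rw [hs'.var _ (by simp [Prog.wv, hr']), hr1]
        have hS2 := hS1.of_same hs' (by simp [Prog.wa])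
        have hE2 := hE1.of_same hs' (by simp [Prog.wa, Prog.wv])
        apply Ex.ite <;> intro htest <;> simp only [Test.Holds, Expr.eval] at htest
        · apply Ex.skip
          rw [sum_lt_succ]
          rcases h' with ⟨h1, h2⟩ | ⟨h1, h2⟩
          · rw [h1] at htest; exact absurd htest one_ne_zero
          · simp [hC2, hI, h2]
        · have hA : st.A t = st.A p := by
            rcases h' with ⟨h1, h2⟩ | ⟨h1, h2⟩
            · exact funext fun i => h2 i i.2
            · exact absurd h1 htest
          apply Ex.ite <;> intro htest2 <;>
            simp only [Test.Holds, Expr.eval, ht2, hr2, hS2.2 t, hS2.2 p, Units.val_inj] at htest2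
          · apply Ex.assign
            rw [sum_lt_succ]
            simp [Expr.eval, hC2, hI, hA, htest2, ht2, hE2.weight]
          · apply Ex.assign
            rw [sum_lt_succ]
            simp [Expr.eval, hC2, hI, hA, htest2, ht2, hE2.weight, sub_eq_add_neg]
    · intro s' h' _
      rw [h', sum_lt_all]
      rfl
  · simp only [Expr.cost, Test.cost, cell]
    rw [← add_assoc, add_right_comm, add_comm]
    gcongr m * ?_ + ?_ <;> omega

theorem constTerm_spec {w : Fin m → ℕ} {s : Store} {st : LinSystem.State n m}
    (hE : Env n w s) (h : SysAt s aBase aBaseSgn st) :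
    Ex constTerm s (m * (n * 100 + 200) + 100) fun s' =>
      s'.var xConst = st.coeff w 0 ∧ Same [xConst, xJ, xQ, xI] [aRow] s s' := by
  refine Ex.withSame ?_ (by simp [constTerm, loadRow, forP, Prog.wv])
    (by simp [constTerm, loadRow, forP, Prog.wa])
  apply Ex.weaken
  · apply Ex.seq
    apply Ex.assign
    apply Ex.forP (N := m) (fun t s₁ => s₁.var xConst = ∑ j : Fin m, if (j : ℕ) < t then
      (if st.A j = 0 then (w j : ℤ) * (st.σ j : ℤˣ) else 0) else 0)
    · simp [hE.numEqs]
    · decide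
    · simp [Prog.wv, forP, loadRow]
    · simp [Prog.wv, forP, loadRow]
    · simp [Expr.eval]
    · intro t s₁ hI ht hs
      have hs := (Same.setVar s _ _).trans hs
      have hE1 := hE.of_same hs (by simp [Prog.wv, Prog.wa, forP, loadRow])
      have hS1 := h.of_same hs (by simp [Prog.wa, forP, loadRow])
      apply Ex.seq
      refine (loadRow_spec t hE1 hS1.1 ht (by decide) (by decide) (by decide)).imp ?_
      rintro s' ⟨⟨hQ, -⟩, hs'⟩
      have ht2 : s'.var xJ = ((t : ℕ) : ℤ) := by rw [hs'.var _ (by decide), ht]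
      have hC2 : s'.var xConst = s₁.var xConst := by rw [hs'.var _ (by decide)]
      have hS2 := hS1.of_same hs' (by decide)
      have hE2 := hE1.of_same hs' (by decide)
      apply Ex.ite <;> intro htest <;>
        simp only [Test.Holds, Expr.eval, hQ, enc_eq_neg_one, LinSystem.pivot_eq_none_iff] at htest
      · apply Ex.ite <;> intro htest2 <;>
          simp only [Test.Holds, Expr.eval, ht2, hS2.2 t] at htest2
        · apply Ex.assign
          rw [sum_lt_succ]
          simp [Expr.eval, hC2, hI, htest, htest2, ht2, hE2.weight]
        · have hσ : st.σ t = -1 :=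
            (Int.units_eq_one_or _).resolve_left fun hc => htest2 (by rw [hc]; rfl)
          apply Ex.assign
          rw [sum_lt_succ]
          simp [Expr.eval, hC2, hI, htest, hσ, ht2, hE2.weight, sub_eq_add_neg]
      · apply Ex.skip
        rw [sum_lt_succ]
        simp [hC2, hI, htest]
    · intro s' h' _
      rw [h', sum_lt_all]
      rfl
  · simp only [Expr.cost, Test.cost]
    rw [← add_assoc, add_right_comm, add_comm]
    gcongr m * ?_ + ?_ <;> omega

/-! ### Correctness of the scan and of one search level -/

open LinSystem (State)

/-- The variables of the scan contain the state `a` of the scan of `st`, with pick number `d`. -/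
structure ScanAt (s : Store) (w : Fin m → ℕ) (st : State n m) (d : ℕ)
    (a : State n m × List (Fin m)) : Prop where
  sys : SysAt s aWork aWorkSgn a.1
  count : s.var xCnt = a.2.length
  pick : s.var xPick = enc a.2[d]?
  pickNet : ∀ p, a.2[d]? = some p → s.var xPickNet = st.net w p

theorem ScanAt.of_same {w : Fin m → ℕ} {s s' : Store} {st : State n m} {d : ℕ}
    {a : State n m × List (Fin m)} {lv la : List ℕ} (h : ScanAt s w st d a) (hs : Same lv la s s')
    (hl : xCnt ∉ lv ∧ xPick ∉ lv ∧ xPickNet ∉ lv ∧ aWork ∉ la ∧ aWorkSgn ∉ la) :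
    ScanAt s' w st d a := by
  obtain ⟨h1, h2, h3, h4⟩ := hl
  exact ⟨h.sys.of_same hs h4, by rw [hs.var _ h1, h.count], by rw [hs.var _ h2, h.pick],
    fun p hp => by rw [hs.var _ h3, h.pickNet p hp]⟩

/-- `aRow` is loaded twice: the original row serves the net weight, the reduced row serves the
independence test and the elimination. The list is not stored; its length and its entry number `d`
suffice. -/
theorem scanRound_spec {w : Fin m → ℕ} {s : Store} {st : State n m} {d : ℕ}
    {a : State n m × List (Fin m)} (p : Fin m) (hE : Env n w s)
    (h : SysAt s aBase aBaseSgn st) (hp : s.var xP = ((p : ℕ) : ℤ)) (hd : s.var xD = d)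
    (ha : ScanAt s w st d a) :
    Ex scanRound s (2 * (m * (n * 100 + 100)) + 2 * (n * 100 + 100) + 500) fun s' =>
      ScanAt s' w st d (st.scanStep w p a) ∧
      Same [xQ, xI, xC, xJ, xE, xPick, xPickNet, xCnt, xG] [aRow, aWork, aWorkSgn] s s' := by
  refine Ex.withSame ?_ (by decide) (by decide)
  apply Ex.weaken
  · apply Ex.seq
    refine (loadRow_spec p hE h.1 hp (by decide) (by decide) (by decide)).imp ?_
    rintro s₁ ⟨⟨-, hrow1⟩, hs1⟩
    have hE1 := hE.of_same hs1 (by decide)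
    have h1 := h.of_same hs1 (by decide)
    have hp1 : s₁.var xP = ((p : ℕ) : ℤ) := by rw [hs1.var _ (by decide), hp]
    have ha1 := ha.of_same hs1 (by decide)
    apply Ex.seq
    refine (netWeight_spec p hE1 h1 hp1 (by decide) hrow1).imp ?_
    rintro s₂ ⟨hnet, hs2⟩
    have hE2 := hE1.of_same hs2 (by decide)
    have h2 := h1.of_same hs2 (by decide)
    have hp2 : s₂.var xP = ((p : ℕ) : ℤ) := by rw [hs2.var _ (by decide), hp1]
    have ha2 := ha1.of_same hs2 (by decide)
    apply Ex.ite <;> intro htest <;> simp only [Test.Holds, Expr.eval, hnet] at htest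
    · apply Ex.skip
      rwa [LinSystem.State.scanStep, if_pos htest]
    rw [LinSystem.State.scanStep, if_neg htest]
    apply Ex.seq
    refine (loadRow_spec p hE2 ha2.sys.1 hp2 (by decide) (by decide) (by decide)).imp ?_
    rintro s₃ ⟨⟨hQ, hrow3⟩, hs3⟩
    have hE3 := hE2.of_same hs3 (by decide)
    have hp3 : s₃.var xP = ((p : ℕ) : ℤ) := by rw [hs3.var _ (by decide), hp2]
    have ha3 := ha2.of_same hs3 (by decide)
    have hnet3 : s₃.var xC = st.net w p := by rw [hs3.var _ (by decide), hnet]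
    have hd3 : s₃.var xD = d := by
      rw [hs3.var _ (by decide), hs2.var _ (by decide), hs1.var _ (by decide), hd]
    apply Ex.ite <;> intro htest2 <;>
      simp only [Test.Holds, Expr.eval, hQ, enc_eq_neg_one] at htest2
    · apply Ex.skip
      rwa [if_pos htest2]
    rw [if_neg htest2]
    obtain ⟨q, hq⟩ := Option.ne_none_iff_exists'.1 htest2
    have hQ3 : s₃.var xQ = ((q : ℕ) : ℤ) := by rw [hQ, hq]; rfl
    rw [LinSystem.State.impose_of_pivot _ hq]
    apply Ex.seq
    have key : Ex (.ite (.eq (.var xCnt) (.var xD))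
        (.seq (.assign xPick (.var xP)) (.assign xPickNet (.var xC))) .skip) s₃ 20 fun s' =>
        (s'.var xPick = enc (a.2 ++ [p])[d]? ∧
          ∀ p', (a.2 ++ [p])[d]? = some p' → s'.var xPickNet = st.net w p') ∧
        Same [xPick, xPickNet] [] s₃ s' := by
      refine Ex.withSame ?_ (by simp [Prog.wv]) (by simp [Prog.wa])
      apply Ex.weaken
      · apply Ex.ite
        · intro ht
          simp only [Test.Holds, Expr.eval, ha3.count, hd3, Nat.cast_inj] at ht
          apply Ex.seq
          apply Ex.assign
          apply Ex.assign
          subst ht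
          simp [Expr.eval, hp3, hnet3, enc]
        · intro ht
          simp only [Test.Holds, Expr.eval, ha3.count, hd3, Nat.cast_inj] at ht
          apply Ex.skip
          -- Appending affects only the lookup at the old length, which is the case excluded here.
          have : (a.2 ++ [p])[d]? = a.2[d]? := by
            rcases lt_or_gt_of_ne ht with hlt | hlt
            · rw [List.getElem?_eq_none (by simp; omega), List.getElem?_eq_none (by omega)]
            · rw [List.getElem?_append_left hlt]
          rw [this]
          exact ⟨ha3.pick, ha3.pickNet⟩
      · simp [Expr.cost, Test.cost]
    refine key.imp ?_
    rintro s₄ ⟨hpick, hs4⟩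
    apply Ex.seq
    apply Ex.assign
    apply Ex.seq
    have hs5 : Same [xPick, xPickNet, xCnt] [] s₃
        (s₄.setVar xCnt ((Expr.add (.var xCnt) (.const 1)).eval s₄)) :=
      (hs4.trans (Same.setVar s₄ _ _)).mono (by simp) (by simp)
    have hcnt5 : (s₄.setVar xCnt ((Expr.add (.var xCnt) (.const 1)).eval s₄)).var xCnt
        = ((a.2 ++ [p]).length : ℕ) := by
      simp [Expr.eval, hs4.var xCnt (by decide), ha3.count]
    have hpick5 : (s₄.setVar xCnt ((Expr.add (.var xCnt) (.const 1)).eval s₄)).var xPick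
        = s₄.var xPick := by simp
    have hpickn5 : (s₄.setVar xCnt ((Expr.add (.var xCnt) (.const 1)).eval s₄)).var xPickNet
        = s₄.var xPickNet := by simp
    generalize s₄.setVar xCnt ((Expr.add (.var xCnt) (.const 1)).eval s₄) = s₅
      at hs5 hcnt5 hpick5 hpickn5 ⊢
    rw [← hpick5, ← hpickn5] at hpick
    have hp5 : s₅.var xP = ((p : ℕ) : ℤ) := by rw [hs5.var _ (by decide), hp3]
    have hsys5 := ha3.sys.of_same hs5 (by decide)
    have hnet5 : s₅.var xC = st.net w p := by rw [hs5.var _ (by decide), hnet3]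
    have key2 : Ex (.ite (.le (.var xC) (.const 0))
        (.assign xG (.get aWorkSgn (.var xP)))
        (.assign xG (.sub (.const 0) (.get aWorkSgn (.var xP))))) s₅ 20 fun s' =>
        s'.var xG = ((if st.net w p ≤ 0 then a.1.σ p else -a.1.σ p : ℤˣ) : ℤ) ∧
        Same [xG] [] s₅ s' := by
      refine Ex.withSame ?_ (by simp [Prog.wv]) (by simp [Prog.wa])
      apply Ex.weaken
      · apply Ex.ite
        · intro ht
          simp only [Test.Holds, Expr.eval, hnet5] at ht
          apply Ex.assign
          simp [Expr.eval, hp5, hsys5.2 p, ht]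
        · intro ht
          simp only [Test.Holds, Expr.eval, hnet5] at ht
          apply Ex.assign
          simp [Expr.eval, hp5, hsys5.2 p, ht]
      · simp [Expr.cost, Test.cost]
    refine key2.imp ?_
    rintro s₆ ⟨hg, hs6⟩
    have hs36 := hs5.trans hs6
    refine (elimSys_spec p q _ (hE3.of_same hs36 (by decide)) (ha3.sys.of_same hs36 (by decide))
      (fun i => by rw [hs36.arr _ (by decide), hrow3]) (by rw [hs36.var _ (by decide), hQ3]) hg
      (by decide) (by decide) (by decide) (by decide) (by decide) (by decide) (by decide)).imp ?_
    rintro s₇ ⟨hsys, hs7⟩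
    have hs57 := hs6.trans hs7
    refine ⟨hsys, ?_, ?_, ?_⟩
    · rw [hs57.var _ (by decide), hcnt5]
    · rw [hs57.var _ (by decide), hpick.1]
    · intro p' hp'
      rw [hs57.var _ (by decide), hpick.2 p' hp']
  · simp only [Expr.cost, Test.cost]
    omega

theorem scanSys_spec {w : Fin m → ℕ} {s : Store} {st : State n m} {d : ℕ} (hE : Env n w s)
    (h : SysAt s aBase aBaseSgn st) (hd : s.var xD = d) :
    Ex scanSys s (m * (n * 100 + 100) + m * (2 * (m * (n * 100 + 100)) + 2 * (n * 100 + 100) + 600)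
        + 200) fun s' =>
      ScanAt s' w st d (st.scan w) ∧
      Same [xQ, xI, xC, xJ, xE, xPick, xPickNet, xCnt, xG, xP] [aRow, aWork, aWorkSgn] s s' := by
  refine Ex.withSame ?_ (by decide) (by decide)
  apply Ex.weaken
  · apply Ex.seq
    refine (copySys_spec hE h (by decide) (by decide) (by decide) (by decide) (by decide)
      (by decide) (by decide) (by decide) (by decide)).imp ?_
    rintro s₁ ⟨h1, hs1⟩
    apply Ex.seq
    apply Ex.assign
    apply Ex.seq
    apply Ex.assign
    have hs2 : Same [xJ, xI, xCnt, xPick] [aWork, aWorkSgn] s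
        ((s₁.setVar xCnt ((Expr.const 0).eval s₁)).setVar xPick
          ((Expr.const (-1)).eval (s₁.setVar xCnt ((Expr.const 0).eval s₁)))) :=
      ((hs1.trans (Same.setVar s₁ _ _)).trans (Same.setVar _ _ _)).mono (by simp) (by simp)
    have hs12 := (Same.setVar s₁ xCnt ((Expr.const 0).eval s₁)).trans
      (Same.setVar (s₁.setVar xCnt ((Expr.const 0).eval s₁)) xPick
        ((Expr.const (-1)).eval (s₁.setVar xCnt ((Expr.const 0).eval s₁))))
    apply Ex.forP (N := m) (fun t s₃ => ScanAt s₃ w st d (LinSystem.iter (st.scanStep w) (st, []) t))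
    · simp [hs1.var xM (by decide), hE.numEqs]
    · decide
    · decide
    · decide
    · refine ⟨(h1.of_same hs12 (by decide)).of_same (Same.setVar _ _ _) (by decide), ?_, ?_, ?_⟩
      · simp [LinSystem.iter, Expr.eval]
      · simp [LinSystem.iter, Expr.eval, enc]
      · simp [LinSystem.iter]
    · intro t s₃ hI ht hs3
      have hs3 := hs2.trans hs3
      refine (scanRound_spec t (hE.of_same hs3 (by decide))
        (h.of_same hs3 (by decide)) ht (by rw [hs3.var _ (by decide), hd])
        hI).imp ?_
      rintro s' ⟨h', -⟩
      rw [LinSystem.iter_succ]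
      exact h'.of_same (Same.setVar _ _ _) (by decide)
    · intro s' h' _
      exact h'
  · simp only [Expr.cost]
    have : m * (2 * (m * (n * 100 + 100)) + 2 * (n * 100 + 100) + 500 + 9) ≤
      m * (2 * (m * (n * 100 + 100)) + 2 * (n * 100 + 100) + 600) :=
      Nat.mul_le_mul_left _ (by omega)
    exact (by omega : ∀ x y z : ℕ, x ≤ y →
      z + 100 + (1 + 1 + (1 + 1 + (x + 7))) ≤ z + y + 200) _ _ _ this

/-- The integer `v` is the truth value of `P`. -/
def Flag (v : ℤ) (P : Prop) : Prop := (P → v = 1) ∧ (¬ P → v = 0)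

theorem Flag.or_of_true {P P' : Prop} (h' : P') : Flag 1 (P ∨ P') :=
  ⟨fun _ => rfl, fun hc => (hc (Or.inr h')).elim⟩

theorem Flag.or_of_false {v : ℤ} {P P' : Prop} (h : Flag v P) (h' : ¬ P') : Flag v (P ∨ P') := by
  simpa [Flag, h'] using h

theorem Flag.congr {v : ℤ} {P P' : Prop} (h : Flag v P) (h' : P ↔ P') : Flag v P' := by
  rwa [← propext h']

theorem ite_assign_spec {s : Store} {t : Test} {P P' : Prop} (h : Flag (s.var xAns) P)
    (ht : t.Holds s ↔ P') :
    Ex (.ite t (.assign xAns (.const 1)) .skip) s (t.cost + 10) fun s' =>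
      Flag (s'.var xAns) (P ∨ P') ∧ Same [xAns] [] s s' := by
  refine Ex.withSame ?_ (by simp [Prog.wv]) (by simp [Prog.wa])
  apply Ex.weaken
  · apply Ex.ite
    · intro h'
      apply Ex.assign
      simpa [Expr.eval] using Flag.or_of_true (ht.1 h')
    · intro h'
      apply Ex.skip
      exact h.or_of_false fun hc => h' (ht.2 hc)
  · simp only [Expr.cost]; omega

/-- A bound for the cost of one level of the search. -/
def levelCost (n m : ℕ) : ℕ :=
  m * (n * 100 + 200) + m * (2 * (m * (n * 100 + 100)) + 2 * (n * 100 + 100) + 600)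
    + 4 * (m * (n * 100 + 100)) + 1000

/-- The search does not stop at a success: `xAns` is only ever raised to 1, so it accumulates a
disjunction, as in the definition of `Run`. -/
theorem levelP_spec {w : Fin m → ℕ} {s : Store} {st : State n m} {d k R : ℕ} {P : Prop}
    (hE : Env n w s) (h : SysAt s aBase aBaseSgn st) (hd : s.var xD = d) (hk : s.var xK = k)
    (hR : s.var xR = R) (hP : Flag (s.var xAns) P) :
    Ex levelP s (levelCost n m) fun s' =>
      (SysAt s' aBase aBaseSgn (st.level w d) ∧
        Flag (s'.var xAns) (P ∨ st.Good w (2 * k) R)) ∧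
      Same [xQ, xI, xC, xJ, xE, xPick, xPickNet, xCnt, xG, xP, xConst, xAns]
        [aRow, aWork, aWorkSgn, aBase, aBaseSgn] s s' := by
  refine Ex.withSame ?_ (by decide) (by decide)
  apply Ex.weaken
  · apply Ex.seq
    refine (constTerm_spec hE h).imp ?_
    rintro s₁ ⟨hc1, hs1⟩
    apply Ex.seq
    refine (scanSys_spec (d := d) (hE.of_same hs1 (by decide)) (h.of_same hs1 (by decide))
      (by rw [hs1.var _ (by decide), hd])).imp ?_
    rintro s₂ ⟨hscan, hs2⟩
    have hs02 := hs1.trans hs2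
    have hc2 : s₂.var xConst = st.coeff w 0 := by rw [hs2.var _ (by decide), hc1]
    have hk2 : s₂.var xK = k := by rw [hs02.var _ (by decide), hk]
    apply Ex.seq
    refine (ite_assign_spec (P := P) (P' := ((2 * k : ℕ) : ℤ) ≤ st.coeff w 0)
      (by rwa [hs02.var _ (by decide)]) ?_).imp ?_
    · simp only [Test.Holds, Expr.eval, hc2, hk2]
      push_cast
      rw [two_mul]
    rintro s₃ ⟨hf3, hs3⟩
    have hs23 := hs3
    have hs3 := hs02.trans hs3
    apply Ex.seq
    refine (ite_assign_spec
      (P' := 0 ≤ st.coeff w 0 ∧ R < (st.scan w).2.length) hf3 ?_).imp ?_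
    · have h1 : s₃.var xConst = st.coeff w 0 := by rw [hs23.var _ (by decide), hc2]
      have h2 : s₃.var xCnt = (st.scan w).2.length := by rw [hs23.var _ (by decide), hscan.count]
      have h3 : s₃.var xR = R := by rw [hs3.var _ (by decide), hR]
      simp only [Test.Holds, Expr.eval, h1, h2, h3, Nat.cast_le, not_le]
    rintro s₄ ⟨hf4, hs4⟩
    have hs24 := hs23.trans hs4
    have hs4 := hs3.trans hs4
    have hf4 := hf4.congr (P' := P ∨ st.Good w (2 * k) R) (by
      unfold LinSystem.State.Good; rw [or_assoc])
    have hscan4 := hscan.of_same hs24 (by decide)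
    have hE4 := hE.of_same hs4 (by decide)
    have h4 := h.of_same hs4 (by decide)
    apply Ex.ite <;> intro htest <;>
      simp only [Test.Holds, Expr.eval, hscan4.pick, enc_eq_neg_one] at htest
    · have hl : st.level w d = (st.scan w).1 := by
        unfold LinSystem.State.level
        rw [htest]
      rw [hl]
      refine (copySys_spec hE4 hscan4.sys (by decide) (by decide) (by decide) (by decide)
        (by decide) (by decide) (by decide) (by decide) (by decide)).imp ?_
      rintro s₅ ⟨h5, hs5⟩
      exact ⟨h5, by rwa [hs5.var _ (by decide)]⟩
    · obtain ⟨p, hp⟩ := Option.ne_none_iff_exists'.1 htest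
      have hl : st.level w d = st.impose p (if st.net w p ≤ 0 then -st.σ p else st.σ p) := by
        unfold LinSystem.State.level
        rw [hp]
      have hAp := ((LinSystem.State.scan_inv w st).mem p (List.mem_of_getElem? hp)).2
      obtain ⟨q, hq⟩ := Option.ne_none_iff_exists'.1
        fun hc => hAp (LinSystem.pivot_eq_none hc)
      rw [hl, LinSystem.State.impose_of_pivot _ hq]
      have hp4 : s₄.var xPick = ((p : ℕ) : ℤ) := by rw [hscan4.pick, hp]; rfl
      have hn4 := hscan4.pickNet p hp
      apply Ex.seq
      -- The bound must not contain `n` alone, which would not be polynomial in `n * m + 1` when `m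
      -- = 0`. A picked equation exists here, so `m` is positive.
      have hpos : n * 100 + 100 ≤ m * (n * 100 + 100) :=
        Nat.le_mul_of_pos_left _ p.pos
      refine ((loadRow_spec p hE4 h4.1 hp4 (by decide) (by decide) (by decide)).weaken hpos).imp ?_
      rintro s₅ ⟨⟨hQ, hrow⟩, hs5⟩
      have h5 := h4.of_same hs5 (by decide)
      have hp5 : s₅.var xPick = ((p : ℕ) : ℤ) := by rw [hs5.var _ (by decide), hp4]
      have hn5 : s₅.var xPickNet = st.net w p := by rw [hs5.var _ (by decide), hn4]
      apply Ex.seq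
      have key2 : Ex (.ite (.le (.var xPickNet) (.const 0))
          (.assign xG (.sub (.const 0) (.get aBaseSgn (.var xPick))))
          (.assign xG (.get aBaseSgn (.var xPick)))) s₅ 20 fun s' =>
          s'.var xG = ((if st.net w p ≤ 0 then -st.σ p else st.σ p : ℤˣ) : ℤ) ∧
          Same [xG] [] s₅ s' := by
        refine Ex.withSame ?_ (by simp [Prog.wv]) (by simp [Prog.wa])
        apply Ex.weaken
        · apply Ex.ite
          · intro ht
            simp only [Test.Holds, Expr.eval, hn5] at ht
            apply Ex.assign
            simp [Expr.eval, hp5, h5.2 p, ht]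
          · intro ht
            simp only [Test.Holds, Expr.eval, hn5] at ht
            apply Ex.assign
            simp [Expr.eval, hp5, h5.2 p, ht]
        · simp [Expr.cost, Test.cost]
      refine key2.imp ?_
      rintro s₆ ⟨hg, hs6⟩
      have hs46 := hs5.trans hs6
      refine (elimSys_spec p q _ (hE4.of_same hs46 (by decide)) (h4.of_same hs46 (by decide))
        (fun i => by rw [hs6.arr _ (by decide), hrow])
        (by rw [hs6.var _ (by decide), hQ, hq]; rfl) hg
        (by decide) (by decide) (by decide) (by decide) (by decide) (by decide) (by decide)).imp ?_
      rintro s₇ ⟨hsys, hs7⟩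
      exact ⟨hsys, by rwa [(hs46.trans hs7).var _ (by decide)]⟩
  · simp only [Expr.cost, Test.cost, levelCost]
    generalize m * (2 * (m * (n * 100 + 100)) + 2 * (n * 100 + 100) + 600) = y
    generalize m * (n * 100 + 100) = z
    generalize m * (n * 100 + 200) = x
    omega

theorem digit_spec {s : Store} {B v P t l : ℕ} (hB : s.var xB = B) (hv : s.var xRem = v)
    (ht : s.var xT = t) (hl : s.var xEll = l)
    (hP : s.arr aPow ((l : ℤ) - 1 - t) = P) (h0 : 0 < P) (hd : v / P ≤ B) :
    Ex digit s (B * 50 + 50) fun s' =>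
      (s'.var xD = (v / P : ℕ) ∧ s'.var xRem = (v % P : ℕ)) ∧
      Same [xTmp, xD, xI, xRem] [] s s' := by
  refine Ex.withSame ?_ (by simp [digit, forP, Prog.wv]) (by simp [digit, forP, Prog.wa])
  apply Ex.weaken
  · apply Ex.seq
    apply Ex.assign
    apply Ex.seq
    apply Ex.assign
    -- Division by repeated subtraction: after `u` rounds, `min u (v / P)` copies of `P` are gone,
    -- and `B` rounds are enough by `hd`.
    apply Ex.forP (N := B) (fun u s₁ => s₁.var xD = (min u (v / P) : ℕ) ∧
      s₁.var xRem = (v : ℤ) - (min u (v / P) : ℕ) * P)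
    · simp [hB]
    · decide
    · simp [Prog.wv]
    · simp [Prog.wv]
    · simp [Expr.eval, hv]
    · intro u s₁ hI hu hs
      have hP1 : s₁.var xTmp = P := by
        rw [hs.var _ (by simp [Prog.wv])]
        simp [Expr.eval, ht, hl, hP]
      have key : (P : ℤ) ≤ v - (min (u : ℕ) (v / P) : ℕ) * P ↔ (u : ℕ) < v / P := by
        rw [← Nat.succ_le_iff, Nat.le_div_iff_mul_le h0]
        rcases le_total (u : ℕ) (v / P) with h1 | h1
        · rw [min_eq_left h1, Nat.succ_mul]
          constructor
          · intro h2
            have : ((u : ℕ) * P + P : ℤ) ≤ v := by linarith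
            exact_mod_cast this
          · intro h2
            have : ((u : ℕ) * P + P : ℤ) ≤ v := by exact_mod_cast h2
            linarith
        · rw [min_eq_right h1]
          have h2 := Nat.lt_div_mul_add h0 (a := v)
          have h3 : ((v : ℕ) : ℤ) < (v / P : ℕ) * P + P := by exact_mod_cast h2
          constructor
          · intro h4; linarith
          · intro h4
            have := Nat.mul_le_mul_right P (Nat.succ_le_succ h1)
            rw [Nat.succ_mul] at this
            omega
      apply Ex.ite <;> intro htest <;> simp only [Test.Holds, Expr.eval, hP1, hI.2, key] at htest
      · apply Ex.seq
        apply Ex.assign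
        apply Ex.assign
        have h2 : min ((u : ℕ) + 1) (v / P) = min (u : ℕ) (v / P) + 1 := by omega
        rw [h2]
        refine ⟨by simp [Expr.eval, hI.1], ?_⟩
        simp [Expr.eval, hI.2, hP1]
        ring
      · apply Ex.skip
        have : min ((u : ℕ) + 1) (v / P) = min (u : ℕ) (v / P) := by omega
        rw [this]
        simpa using hI
    · intro s' h' _
      rw [min_eq_right hd] at h'
      refine ⟨h'.1, ?_⟩
      rw [h'.2]
      have := Nat.div_add_mod' v P
      have h2 : ((v / P : ℕ) : ℤ) * P + (v % P : ℕ) = v := by exact_mod_cast this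
      linarith
  · simp only [Expr.cost, Test.cost]; omega

/-- A bound for the cost of one branch of the search. -/
def branchCost (n m B l : ℕ) : ℕ :=
  m * (n * 100 + 100) + 200 + l * (B * 50 + levelCost n m + 100)

theorem branch_spec {w : Fin m → ℕ} {s : Store} {st : State n m} {k R l v : ℕ} {P : Prop}
    (hE : Env n w s) (h : SysAt s aMat aRhs st) (hk : s.var xK = k) (hR : s.var xR = R)
    (hB : s.var xB = (R + 1 : ℕ)) (hl : s.var xEll = l) (hv : s.var xV = v)
    (hpow : ∀ e < l, s.arr aPow (e : ℤ) = ((R + 1) ^ e : ℕ)) (hvl : v < (R + 1) ^ l)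
    (hP : Flag (s.var xAns) P) :
    Ex branch s (branchCost n m (R + 1) l) fun s' =>
      Flag (s'.var xAns) (P ∨ st.Run w (2 * k) R l v) ∧
      Same [xQ, xI, xC, xJ, xE, xPick, xPickNet, xCnt, xG, xP, xConst, xAns, xRem, xT, xD, xTmp]
        [aRow, aWork, aWorkSgn, aBase, aBaseSgn] s s' := by
  refine Ex.withSame ?_ (by decide) (by decide)
  apply Ex.weaken
  · apply Ex.seq
    refine (copySys_spec hE h (by decide) (by decide) (by decide) (by decide)
        (by decide) (by decide) (by decide) (by decide) (by decide)).imp ?_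
    rintro s₁ ⟨h1, hs1⟩
    apply Ex.seq
    apply Ex.assign
    have hs2 := hs1.trans (Same.setVar s₁ xRem ((Expr.var xV).eval s₁))
    have hrem2 : (s₁.setVar xRem ((Expr.var xV).eval s₁)).var xRem = v := by
      simp [Expr.eval, hs1.var xV (by decide), hv]
    have h2 := h1.of_same (Same.setVar s₁ xRem ((Expr.var xV).eval s₁)) (by decide)
    generalize s₁.setVar xRem ((Expr.var xV).eval s₁) = s₂ at hs2 hrem2 h2 ⊢
    -- The answer so far together with the rest of the run from the current node is equivalent to
    -- the whole run. At the end the rest is `False`, and the flag is the result.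
    apply Ex.forP (N := l) (fun t s₃ => ∃ (st' : State n m) (v' : ℕ) (P' : Prop),
      SysAt s₃ aBase aBaseSgn st' ∧ s₃.var xRem = v' ∧ Flag (s₃.var xAns) P' ∧
      v' < (R + 1) ^ (l - t) ∧
      ((P' ∨ st'.Run w (2 * k) R (l - t) v') ↔ (P ∨ st.Run w (2 * k) R l v)))
    · rw [hs2.var _ (by decide), hl]
    · decide
    · decide
    · decide
    · refine ⟨st, v, P, h2.of_same (Same.setVar _ _ _) (by decide), by simpa using hrem2, ?_, hvl,
        Iff.rfl⟩
      simpa [hs2.var xAns (by decide)] using hP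
    · rintro t s₃ ⟨st', v', P', h3, hrem3, hP3, hv3, hiff⟩ ht hs3
      have hs3 := hs2.trans hs3
      -- Digits are consumed from the most significant one, so level `t` divides by the power with
      -- exponent `e = l - 1 - t`.
      obtain ⟨e, he⟩ : ∃ e, l - (t : ℕ) = e + 1 := ⟨l - t - 1, by omega⟩
      have he' : l - ((t : ℕ) + 1) = e := by omega
      rw [he] at hv3 hiff
      rw [he']
      have hpos : 0 < (R + 1) ^ e := by positivity
      apply Ex.seq
      refine (digit_spec (B := R + 1) (v := v') (P := (R + 1) ^ e) (t := t) (l := l)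
        (by rw [hs3.var _ (by decide), hB]) hrem3 ht (by rw [hs3.var _ (by decide), hl]) ?_ hpos
        ?_).imp ?_
      · rw [hs3.arr _ (by decide)]
        have : (l : ℤ) - 1 - ((t : ℕ) : ℤ) = (e : ℕ) := by omega
        rw [this, hpow e (by omega)]
      · rw [pow_succ, mul_comm] at hv3
        exact (Nat.div_lt_of_lt_mul (by rwa [mul_comm] at hv3)).le
      rintro s₄ ⟨⟨hD4, hrem4⟩, hs4⟩
      have hs04 := hs3.trans hs4
      refine (levelP_spec (d := v' / (R + 1) ^ e) (k := k) (R := R) (P := P')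
        (hE.of_same hs04 (by decide)) (h3.of_same hs4 (by decide)) hD4
        (by rw [hs04.var _ (by decide), hk]) (by rw [hs04.var _ (by decide), hR])
        (by rwa [hs4.var _ (by decide)])).imp ?_
      rintro s₅ ⟨⟨h5, hP5⟩, hs5⟩
      refine ⟨st'.level w (v' / (R + 1) ^ e), v' % (R + 1) ^ e,
        P' ∨ st'.Good w (2 * k) R, h5.of_same (Same.setVar _ _ _) (by decide), ?_,
        by simpa using hP5, Nat.mod_lt _ hpos, ?_⟩
      · simp [hs5.var xRem (by decide), hrem4]
      · rw [← hiff, LinSystem.State.Run, or_assoc]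
    · rintro s' ⟨st', v', P', -, -, hP', -, hiff⟩ _
      refine hP'.congr ?_
      rw [Nat.sub_self, LinSystem.State.Run, or_false] at hiff
      exact hiff
  · simp only [Expr.cost, branchCost]
    have : l * ((R + 1) * 50 + 50 + levelCost n m + 9)
      ≤ l * ((R + 1) * 50 + levelCost n m + 100) := Nat.mul_le_mul_left _ (by omega)
    exact (by omega : ∀ x y z : ℕ, x ≤ y → z + 100 + (1 + 1 + (x + 7)) ≤ z + 200 + y) _ _ _ this

/-! ### Precomputation and the complete algorithm -/

theorem offsets_spec {w : Fin m → ℕ} {s : Store} (hn : s.var xN = n) (hm : s.var xM = m)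
    (hw : ∀ j : Fin m, s.arr aWt ((j : ℕ) : ℤ) = w j) :
    Ex offsets s (m * 30 + 30) fun s' => Env n w s' ∧ Same [xTmp, xJ] [aOff] s s' := by
  have : Ex offsets s (m * 30 + 30) fun s' =>
      (∀ j : Fin m, s'.arr aOff ((j : ℕ) : ℤ) = ((j : ℕ) : ℤ) * n) ∧
        Same [xTmp, xJ] [aOff] s s' := by
    refine Ex.withSame ?_ (by decide) (by decide)
    apply Ex.weaken
    · apply Ex.seq
      apply Ex.assign
      apply Ex.forP (N := m) (fun t s₁ => s₁.var xTmp = (t : ℤ) * n ∧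
        ∀ j : Fin m, (j : ℕ) < t → s₁.arr aOff ((j : ℕ) : ℤ) = ((j : ℕ) : ℤ) * n)
      · simp [hm]
      · decide
      · decide
      · decide
      · simp [Expr.eval]
      · intro t s₁ hI ht hs
        have hn1 : s₁.var xN = n := by rw [hs.var _ (by decide)]; simp [hn]
        apply Ex.seq
        apply Ex.store
        apply Ex.assign
        rw [forall_lt_succ_iff]
        refine ⟨?_, fun j hj => ?_, ?_⟩
        · simp [Expr.eval, hI.1, hn1]
          ring
        · simp [Expr.eval, ht, hI.2 j hj, hj.ne]
        · simp [Expr.eval, ht, hI.1]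
      · intro s' h' _
        exact fun j => h'.2 j j.2
    · simp only [Expr.cost]; omega
  refine this.imp ?_
  rintro s' ⟨h, hs⟩
  exact ⟨⟨by rw [hs.var _ (by decide), hn], by rw [hs.var _ (by decide), hm],
    fun j => by rw [hs.arr _ (by decide), hw], h⟩, hs⟩

theorem logM_spec {s : Store} (hm : s.var xM = m) :
    Ex logM s (m * 50 + 50) fun s' =>
      (∃ L : ℕ, s'.var xL = L ∧ m + 1 ≤ 2 ^ L ∧ 2 ^ L ≤ 2 * m + 1) ∧
        Same [xL, xPow, xJ] [] s s' := by
  refine Ex.withSame ?_ (by decide) (by decide)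
  apply Ex.weaken
  · apply Ex.seq
    apply Ex.assign
    apply Ex.seq
    apply Ex.assign
    -- Doubling happens only while `2 ^ L ≤ m`, whence the upper bound. If it happens in all `m`
    -- rounds, `m < 2 ^ m` gives the lower bound.
    apply Ex.forP (N := m) (fun t s₁ => ∃ L : ℕ, s₁.var xL = L ∧ s₁.var xPow = (2 ^ L : ℕ) ∧
      (m < 2 ^ L ∨ L = t) ∧ 2 ^ L ≤ 2 * m + 1)
    · simp [hm]
    · decide
    · decide
    · decide
    · exact ⟨0, by simp [Expr.eval]⟩
    · rintro t s₁ ⟨L, hL, hpow, hor, hle⟩ ht hs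
      have hm1 : s₁.var xM = m := by rw [hs.var _ (by decide)]; simp [hm]
      apply Ex.ite <;> intro htest <;>
        simp only [Test.Holds, Expr.eval, hm1, hpow, Nat.cast_le] at htest
      · apply Ex.seq
        apply Ex.assign
        apply Ex.assign
        refine ⟨L + 1, by simp [Expr.eval, hL], ?_, by omega, by rw [pow_succ]; omega⟩
        simp only [Expr.eval, Store.setVar_var, hpow]
        norm_num
        ring
      · apply Ex.skip
        exact ⟨L, by simpa using hL, by simpa using hpow, by omega, hle⟩
    · rintro s' ⟨L, hL, hpow, hor, hle⟩ _
      refine ⟨L, hL, ?_, hle⟩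
      rcases hor with h | h
      · exact h
      · rw [h]; exact Nat.lt_two_pow_self
  · simp only [Expr.cost, Test.cost]; omega

theorem bounds_spec {s : Store} {k L : ℕ} (hk : s.var xK = k) (hL : s.var xL = L) :
    Ex bounds s (L * 30 + 50) fun s' =>
      (s'.var xEll = (2 * k + 1 : ℕ) ∧ s'.var xR = (L * (2 * k + 1) : ℕ) ∧
        s'.var xB = (L * (2 * k + 1) + 1 : ℕ)) ∧ Same [xEll, xR, xJ, xB] [] s s' := by
  refine Ex.withSame ?_ (by decide) (by decide)
  apply Ex.weaken
  · apply Ex.seq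
    apply Ex.assign
    apply Ex.seq
    apply Ex.assign
    apply Ex.seq
    apply Ex.forP (N := L) (fun t s₁ => s₁.var xR = (t * (2 * k + 1) : ℕ) ∧
      s₁.var xEll = (2 * k + 1 : ℕ))
    · simp [hL]
    · decide
    · decide
    · decide
    · simp [Expr.eval, hk]; ring
    · intro t s₁ hI ht hs
      apply Ex.assign
      simp only [Expr.eval, Store.setVar_var, hI.1, hI.2]
      norm_num
      ring
    · intro s' h' _
      apply Ex.assign
      simp [Expr.eval, h'.1, h'.2]
  · simp only [Expr.cost]; omega

theorem powers_spec {s : Store} {l B : ℕ} (hl : s.var xEll = l) (hB : s.var xB = B) :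
    Ex powers s (l * (B * 30 + 50) + 50) fun s' =>
      (∀ e ≤ l, s'.arr aPow (e : ℤ) = (B ^ e : ℕ)) ∧ Same [xJ, xTmp, xI] [aPow] s s' := by
  refine Ex.withSame ?_ (by decide) (by decide)
  apply Ex.weaken
  · apply Ex.seq
    apply Ex.store
    apply Ex.forP (N := l) (fun t s₁ => ∀ e ≤ t, s₁.arr aPow (e : ℤ) = (B ^ e : ℕ))
    · simp [hl]
    · decide
    · decide
    · decide
    · intro e he
      have : e = 0 := by omega
      subst this
      simp [Expr.eval]
    · intro t s₁ hI ht hs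
      have hB1 : s₁.var xB = B := by rw [hs.var _ (by decide)]; simp [hB]
      apply Ex.seq
      apply Ex.assign
      apply Ex.seq
      apply Ex.forP (N := B) (fun u s₂ => s₂.var xTmp = (u * B ^ (t : ℕ) : ℕ))
      · simp [hB1]
      · decide
      · decide
      · decide
      · simp [Expr.eval]
      · intro u s₂ hI2 hu hs2
        apply Ex.assign
        have h1 : s₂.arr aPow (s₂.var xJ) = (B ^ (t : ℕ) : ℕ) := by
          rw [hs2.var xJ (by decide), hs2.arr _ (by decide)]
          simp [ht, hI t le_rfl]
        simp only [Expr.eval, Store.setVar_var, hI2, h1]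
        norm_num
        ring
      · intro s' h' hs'
        apply Ex.store
        have ht' : s'.var xJ = ((t : ℕ) : ℤ) := by rw [hs'.var _ (by decide)]; simp [ht]
        intro e he
        simp only [Expr.eval, ht', h', Store.setVar_arr, Store.setArr_arr, true_and]
        rcases Nat.le_succ_iff.1 he with h | h
        · have : (e : ℤ) ≠ ((t : ℕ) : ℤ) + 1 := by omega
          rw [if_neg this, hs'.arr _ (by decide)]
          simpa using hI e h
        · subst h
          rw [if_pos (by push_cast; rfl), Nat.pow_succ']
    · intro s' h' _
      exact h'
  · simp only [Expr.cost]
    have : l * (1 + 1 + (B * (1 + (1 + 1) + 1 + 1 + 9) + 7 + (1 + 1 + 1 + 1 + 1)) + 9)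
      ≤ l * (B * 30 + 50) := Nat.mul_le_mul_left _ (by omega)
    omega

/-- A bound for the cost of the complete algorithm. -/
def solverCost (n m k L : ℕ) : ℕ :=
  m * 80 + L * 30 + (2 * k + 1) * ((L * (2 * k + 1) + 1) * 30 + 50) +
    (L * (2 * k + 1) + 1) ^ (2 * k + 1) *
      (branchCost n m (L * (2 * k + 1) + 1) (2 * k + 1) + 9) + 300

theorem solver_spec {w : Fin m → ℕ} {s : Store} {st : State n m} {k : ℕ}
    (hn : s.var xN = n) (hm : s.var xM = m) (hk : s.var xK = k)
    (hw : ∀ j : Fin m, s.arr aWt ((j : ℕ) : ℤ) = w j) (h : SysAt s aMat aRhs st) :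
    ∃ L : ℕ, m + 1 ≤ 2 ^ L ∧ 2 ^ L ≤ 2 * m + 1 ∧
      Ex solver s (solverCost n m k L) fun s' => Flag (s'.var xN)
        (∃ v < (L * (2 * k + 1) + 1) ^ (2 * k + 1),
          st.Run w (2 * k) (L * (2 * k + 1)) (2 * k + 1) v) := by
  -- The cost bound mentions `L`, so `L` is needed before the run. It is read off from `logM`
  -- started in `s`; the value found in the actual run agrees, because the two inequalities
  -- determine `L`.
  obtain ⟨L, hL1, hL2⟩ : ∃ L : ℕ, m + 1 ≤ 2 ^ L ∧ 2 ^ L ≤ 2 * m + 1 := by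
    obtain ⟨_, _, _, _, ⟨L, -, h1, h2⟩, -⟩ := logM_spec (m := m) hm
    exact ⟨L, h1, h2⟩
  refine ⟨L, hL1, hL2, ?_⟩
  apply Ex.weaken
  · apply Ex.seq
    refine (offsets_spec hn hm hw).imp ?_
    rintro s₁ ⟨hE1, hs1⟩
    apply Ex.seq
    refine (logM_spec hE1.numEqs).imp ?_
    rintro s₂ ⟨⟨L', hL', hL1', hL2'⟩, hs2⟩
    have hLL : L' = L := by
      have h1 : (2 : ℕ) ^ L' < 2 ^ (L + 1) := by rw [pow_succ]; omega
      have h2 : (2 : ℕ) ^ L < 2 ^ (L' + 1) := by rw [pow_succ]; omega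
      have h3 := (Nat.pow_lt_pow_iff_right (by norm_num)).1 h1
      have h4 := (Nat.pow_lt_pow_iff_right (by norm_num)).1 h2
      omega
    subst hLL
    have hs02 := hs1.trans hs2
    apply Ex.seq
    refine (bounds_spec (k := k) (by rw [hs02.var _ (by decide), hk]) hL').imp ?_
    rintro s₃ ⟨⟨hl3, hR3, hB3⟩, hs3⟩
    have hs03 := hs02.trans hs3
    apply Ex.seq
    refine (powers_spec hl3 hB3).imp ?_
    rintro s₄ ⟨hpow4, hs4⟩
    have hs04 := hs03.trans hs4
    have hs14 := (hs2.trans hs3).trans hs4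
    apply Ex.seq
    apply Ex.assign
    have hs5 := Same.setVar s₄ xTot ((Expr.get aPow (.var xEll)).eval s₄)
    have htot5 : (s₄.setVar xTot ((Expr.get aPow (.var xEll)).eval s₄)).var xTot
        = ((L' * (2 * k + 1) + 1) ^ (2 * k + 1) : ℕ) := by
      simp only [Store.setVar_var, if_true, Expr.eval]
      rw [hs4.var _ (by decide), hl3, hpow4 _ le_rfl]
    generalize s₄.setVar xTot ((Expr.get aPow (.var xEll)).eval s₄) = s₅ at hs5 htot5 ⊢
    apply Ex.seq
    apply Ex.assign
    have hs6 := Same.setVar s₅ xAns ((Expr.const 0).eval s₅)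
    have hans6 : (s₅.setVar xAns ((Expr.const 0).eval s₅)).var xAns = 0 := by simp [Expr.eval]
    generalize s₅.setVar xAns ((Expr.const 0).eval s₅) = s₆ at hs6 hans6 ⊢
    have hs46 := hs5.trans hs6
    have hs36 := hs4.trans hs46
    have hs06 := hs04.trans hs46
    apply Ex.seq
    -- After `t` rounds the flag tells whether one of the first `t` branches succeeds.
    apply Ex.forP (N := (L' * (2 * k + 1) + 1) ^ (2 * k + 1)) (fun t s₇ => Flag (s₇.var xAns)
      (∃ v < t, st.Run w (2 * k) (L' * (2 * k + 1)) (2 * k + 1) v))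
    · rw [hs6.var _ (by decide), htot5]
    · decide
    · decide
    · decide
    · simp [Flag, hans6]
    · intro t s₇ hI ht hs7
      have hs37 := hs36.trans hs7
      have hs47 := hs46.trans hs7
      have hs07 := hs06.trans hs7
      refine (branch_spec (k := k) (R := L' * (2 * k + 1)) (l := 2 * k + 1) (v := t)
        (hE1.of_same (hs14.trans hs47) (by decide)) (h.of_same hs07 (by decide))
        (by rw [hs07.var _ (by decide), hk]) (by rw [hs37.var _ (by decide), hR3])
        (by rw [hs37.var _ (by decide), hB3]) (by rw [hs37.var _ (by decide), hl3]) ht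
        (fun e he => by rw [hs47.arr _ (by decide), hpow4 e he.le]) t.2 hI).imp ?_
      rintro s₈ ⟨h8, -⟩
      have h9 : Flag (s₈.var xAns)
          (∃ v < (t : ℕ) + 1, st.Run w (2 * k) (L' * (2 * k + 1)) (2 * k + 1) v) := by
        refine h8.congr ?_
        constructor
        · rintro (⟨v, hv, hr⟩ | hr)
          · exact ⟨v, by omega, hr⟩
          · exact ⟨t, by omega, hr⟩
        · rintro ⟨v, hv, hr⟩
          rcases Nat.lt_succ_iff_lt_or_eq.1 hv with h | h
          · exact Or.inl ⟨v, h, hr⟩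
          · exact Or.inr (h ▸ hr)
      simpa using h9
    · intro s' h' _
      apply Ex.assign
      simpa [Expr.eval] using h'
  · simp only [Expr.cost, solverCost]
    omega

end RAM

namespace LinSystem

variable {n m : ℕ}

theorem sysAt_input (S : LinSystem n m) (k : ℕ) : RAM.SysAt (S.input k) 0 1 S.initial := by
  classical
  constructor
  · intro j i
    have key : (∃ (j' : Fin m) (i' : Fin n), ((j : ℕ) : ℤ) * n + ((i : ℕ) : ℤ)
        = ((j' : ℕ) : ℤ) * n + ((i' : ℕ) : ℤ) ∧ i' ∈ S.supp j') ↔ i ∈ S.supp j := by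
      constructor
      · rintro ⟨j', i', h, hi⟩
        obtain ⟨h1, h2⟩ := (RAM.cell_inj i.2 i'.2).1 h
        rwa [Fin.ext h1, Fin.ext h2]
      · exact fun h => ⟨j, i, rfl, h⟩
    simp only [input, key, initial, RAM.bit]
    split_ifs <;> simp_all
  · intro j
    simp only [input, Nat.cast_inj, ← Fin.ext_iff]
    simp [initial]

theorem weight_input (S : LinSystem n m) (k : ℕ) (j : Fin m) :
    (S.input k).arr 2 ((j : ℕ) : ℤ) = S.weight j := by
  simp only [input, Nat.cast_inj, ← Fin.ext_iff]
  simp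

end LinSystem

/-! ### The running time -/

/-- In this bound `n` occurs only in products with `m`, so `m` and `m * n` control everything. -/
theorem levelCost_le {n m Z : ℕ} (h1 : 1 ≤ Z) (hm : m ≤ Z) (hmn : m * n ≤ Z) :
    RAM.levelCost n m ≤ 4000 * Z ^ 2 := by
  unfold RAM.levelCost
  have h2 : m * (n * 100 + 100) ≤ 200 * Z := by nlinarith
  have h3 : m * (2 * (m * (n * 100 + 100)) + 2 * (n * 100 + 100) + 600)
      = 2 * (m * (m * (n * 100 + 100))) + 2 * (m * (n * 100 + 100)) + 600 * m := by ring
  have h4 : m * (m * (n * 100 + 100)) ≤ Z * (200 * Z) := Nat.mul_le_mul hm h2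
  have h5 : m * (n * 100 + 200) = m * (n * 100 + 100) + 100 * m := by ring
  have h6 : Z ≤ Z ^ 2 := by nlinarith
  rw [h3, h5]
  nlinarith

theorem solverCost_le {n m k L Z : ℕ} (h1 : 1 ≤ Z) (hm : m ≤ Z) (hmn : m * n ≤ Z)
    (hL : 2 ^ L ≤ 2 * m + 1) :
    RAM.solverCost n m k L ≤
      6000 * ((L * (2 * k + 1) + 1) ^ (2 * k + 2) * (2 * k + 1)) * Z ^ 2 := by
  unfold RAM.solverCost RAM.branchCost
  have hLZ : L ≤ 3 * Z := by
    have : L < 2 ^ L := Nat.lt_two_pow_self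
    omega
  set B := L * (2 * k + 1) + 1 with hB
  set l := 2 * k + 1 with hl
  have hB1 : 1 ≤ B := by omega
  have hl1 : 1 ≤ l := by omega
  have hD1 : 1 ≤ B ^ l := Nat.one_le_pow _ _ hB1
  have hlev := levelCost_le h1 hm hmn
  have hZ : Z ≤ Z ^ 2 := by nlinarith
  have h2 : m * (n * 100 + 100) ≤ 200 * Z := by nlinarith
  have hpow : B ^ (2 * k + 2) = B ^ l * B := by rw [← pow_succ]
  rw [hpow]
  set D := B ^ l
  have hlB : 1 ≤ l * B := Nat.mul_pos hl1 hB1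
  -- A common unit: one branch costs at most `4600 * Y`, the precomputation at most `600 * Y`.
  set Y := l * B * Z ^ 2 with hY
  have hZY : Z ^ 2 ≤ Y := Nat.le_mul_of_pos_left _ hlB
  have hY1 : 1 ≤ Y := by omega
  have hlY : l ≤ Y := by
    calc l = l * 1 * 1 := by ring
      _ ≤ l * B * Z ^ 2 := Nat.mul_le_mul (Nat.mul_le_mul_left _ hB1) (by omega)
  have hlBY : l * B ≤ Y := Nat.le_mul_of_pos_right _ (by omega)
  have hlZY : l * Z ^ 2 ≤ Y := by
    calc l * Z ^ 2 = l * 1 * Z ^ 2 := by ring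
      _ ≤ l * B * Z ^ 2 := Nat.mul_le_mul_right _ (Nat.mul_le_mul_left _ hB1)
  have hbr : m * (n * 100 + 100) + 200 + l * (B * 50 + RAM.levelCost n m + 100) + 9
      ≤ 4600 * Y := by
    have h3 : l * (B * 50 + RAM.levelCost n m + 100) ≤ l * (B * 50 + 4000 * Z ^ 2 + 100) :=
      Nat.mul_le_mul_left _ (by omega)
    have h4 : l * (B * 50 + 4000 * Z ^ 2 + 100) = 50 * (l * B) + 4000 * (l * Z ^ 2) + 100 * l := by
      ring
    omega
  have hpre : m * 80 + L * 30 + l * (B * 30 + 50) + 300 ≤ 600 * Y := by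
    have h4 : l * (B * 30 + 50) = 30 * (l * B) + 50 * l := by ring
    omega
  have hDY : Y ≤ D * Y := Nat.le_mul_of_pos_left _ hD1
  have hmain := Nat.mul_le_mul_left D hbr
  have : 6000 * (D * B * l) * Z ^ 2 = 6000 * (D * Y) := by rw [hY]; ring
  rw [this]
  have h7 : D * (4600 * Y) = 4600 * (D * Y) := by ring
  omega

/-- A power of a logarithm is bounded by a polynomial times a factor that only depends on the
exponent. -/
theorem pow_le_pow_mul_two_pow (l e : ℕ) : l ^ e ≤ e ^ e * 2 ^ (l + e) := by
  calc l ^ e ≤ (l + e).descFactorial e := by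
        have := Nat.pow_sub_le_descFactorial (l + e) e
        exact (Nat.pow_le_pow_left (by omega) e).trans this
    _ = e.factorial * (l + e).choose e := Nat.descFactorial_eq_factorial_mul_choose _ _
    _ ≤ e ^ e * 2 ^ (l + e) := Nat.mul_le_mul (Nat.factorial_le_pow e) (Nat.choose_le_two_pow _ _)

/-- The power of the logarithm `L + 1` is traded for `e ^ e * 2 ^ (L + 1 + e)`. Here `2 ^ (L + 1) ≤
6 * Z`, so `m` contributes just one factor `Z` and everything else depends on `k` alone. -/
theorem search_size_le {m k L Z : ℕ} (h1 : 1 ≤ Z) (hm : m ≤ Z) (hL : 2 ^ L ≤ 2 * m + 1) :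
    (L * (2 * k + 1) + 1) ^ (2 * k + 2) * (2 * k + 1) ≤ 6 * (4 * k + 4) ^ (4 * k + 5) * Z := by
  set e := 2 * k + 2 with he
  have hb : L * (2 * k + 1) + 1 ≤ (L + 1) * e := by rw [he]; nlinarith
  have h2 : (L + 1) ^ e ≤ e ^ e * (2 ^ e * (6 * Z)) := by
    refine (pow_le_pow_mul_two_pow _ _).trans (Nat.mul_le_mul_left _ ?_)
    rw [pow_add, mul_comm]
    refine Nat.mul_le_mul_left _ ?_
    rw [pow_succ]
    omega
  calc (L * (2 * k + 1) + 1) ^ e * (2 * k + 1)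
      ≤ ((L + 1) * e) ^ e * (4 * k + 4) := Nat.mul_le_mul (Nat.pow_le_pow_left hb _) (by omega)
    _ = (L + 1) ^ e * e ^ e * (4 * k + 4) := by rw [mul_pow]
    _ ≤ e ^ e * (2 ^ e * (6 * Z)) * e ^ e * (4 * k + 4) := by gcongr
    _ = 6 * (e ^ e * ((2 * e) ^ e * (4 * k + 4))) * Z := by rw [mul_pow]; ring
    _ ≤ 6 * ((4 * k + 4) ^ e * ((4 * k + 4) ^ e * (4 * k + 4))) * Z := by
        gcongr <;> omega
    _ = 6 * (4 * k + 4) ^ (4 * k + 5) * Z := by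
        rw [← pow_succ, ← pow_add]
        congr 3
        omega

theorem pow_le_two_rpow (k : ℕ) :
    ((4 * k + 4 : ℕ) : ℝ) ^ (4 * k + 5) ≤ 8 ^ 9 * (2 : ℝ) ^ (36 * ((k : ℝ) * Real.logb 2 k)) := by
  rcases Nat.lt_or_ge k 2 with hk | hk
  -- For `k ≤ 1` the exponent `k log k` is 0; the factor `8 ^ 9` is the value of the left side at `k
  -- = 1`.
  · interval_cases k <;> norm_num
  · have hkpos : (0 : ℝ) < k := by positivity
    have h1 : (2 : ℝ) ^ (36 * ((k : ℝ) * Real.logb 2 k)) = (k : ℝ) ^ (36 * k) := by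
      rw [show 36 * ((k : ℝ) * Real.logb 2 k) = Real.logb 2 k * ((36 * k : ℕ) : ℝ) by push_cast; ring,
        Real.rpow_mul_natCast (by norm_num), Real.rpow_logb (by norm_num) (by norm_num) hkpos]
    rw [h1]
    have h2 : (4 * k + 4) ^ (4 * k + 5) ≤ k ^ (36 * k) := by
      -- This needs `k ≥ 2`; the exponent then becomes `4 * (4 * k + 5) = 16 * k + 20 ≤ 36 * k`.
      have h3 : 4 * k + 4 ≤ k ^ 4 := by
        have : 2 * 2 * 2 ≤ k * k * k := Nat.mul_le_mul (Nat.mul_le_mul hk hk) hk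
        have h5 : k ^ 4 = k * k * k * k := by ring
        rw [h5]
        nlinarith
      calc (4 * k + 4) ^ (4 * k + 5) ≤ (k ^ 4) ^ (4 * k + 5) := Nat.pow_le_pow_left h3 _
        _ = k ^ (4 * (4 * k + 5)) := by rw [← pow_mul]
        _ ≤ k ^ (36 * k) := Nat.pow_le_pow_right (by omega) (by omega)
    have h4 : ((4 * k + 4 : ℕ) : ℝ) ^ (4 * k + 5) ≤ (k : ℝ) ^ (36 * k) := by exact_mod_cast h2
    have h5 : (0 : ℝ) ≤ (k : ℝ) ^ (36 * k) := by positivity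
    linarith

theorem mul_logb_nonneg (k : ℕ) : 0 ≤ (k : ℝ) * Real.logb 2 k := by
  rcases Nat.eq_zero_or_pos k with h | h
  · simp [h]
  · exact mul_nonneg (by positivity) (Real.logb_nonneg (by norm_num) (by exact_mod_cast h))

theorem corollary1 :
    ∃ (p : RAM.Prog) (C : ℕ), ∀ (n m : ℕ) (S : LinSystem n m) (k : ℕ),
      SolvesWithin p S k
        (C * (2 : ℝ) ^ ((C : ℝ) * (k * Real.logb 2 k)) * ((n : ℝ) * m + 1) ^ C) := by
  -- The leading factor dictates `C`, which also exceeds the 36 in the exponent and the degree 3. It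
  -- is kept opaque to prevent its evaluation.
  obtain ⟨C, hC⟩ : ∃ C : ℕ, C = 36000 * 8 ^ 9 := ⟨_, rfl⟩
  refine ⟨RAM.solver, C, fun n m S k => ?_⟩
  obtain ⟨L, hL1, hL2, T, s, hexec, hT, hyes, hno⟩ :=
    RAM.solver_spec (w := S.weight) (st := S.initial) (k := k) rfl rfl rfl (S.weight_input k)
      (S.sysAt_input k)
  -- `L * (2 * k)` would do; the program adds `xEll = 2 * k + 1` to itself `L` times, which gives
  -- slightly more.
  have hR : (m + 1) ^ (2 * k) ≤ 2 ^ (L * (2 * k + 1)) := by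
    rw [pow_mul 2 L]
    calc (m + 1) ^ (2 * k) ≤ (2 ^ L) ^ (2 * k) := Nat.pow_le_pow_left hL1 _
      _ ≤ (2 ^ L) ^ (2 * k + 1) := Nat.pow_le_pow_right (by positivity) (by omega)
  have hiff := S.isYes_iff_run k _ hR
  refine ⟨T, s, hexec, ?_, fun h => hyes (hiff.1 h), fun h => hno fun h' => h (hiff.2 h')⟩
  set Z := n * m + 1 with hZ
  -- If there is an equation, its nonempty support forces `n ≥ 1`.
  have hm : m ≤ Z := by
    rcases Nat.eq_zero_or_pos m with h | h
    · omega
    · obtain ⟨i, -⟩ := S.supp_nonempty ⟨0, h⟩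
      have := Nat.le_mul_of_pos_left m i.pos
      omega
  have hmn : m * n ≤ Z := by rw [mul_comm]; omega
  have hZ1 : 1 ≤ Z := by omega
  have hT' : T ≤ 36000 * (4 * k + 4) ^ (4 * k + 5) * Z ^ 3 := by
    calc T ≤ _ := hT
      _ ≤ _ := solverCost_le hZ1 hm hmn hL2
      _ ≤ 6000 * (6 * (4 * k + 4) ^ (4 * k + 5) * Z) * Z ^ 2 := by
          exact Nat.mul_le_mul_right _ (Nat.mul_le_mul_left _ (search_size_le hZ1 hm hL2))
      _ = _ := by ring
  have hT2 : (T : ℝ) ≤ 36000 * ((4 * k + 4 : ℕ) : ℝ) ^ (4 * k + 5) * ((n : ℝ) * m + 1) ^ 3 := by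
    have : (T : ℝ) ≤ ((36000 * (4 * k + 4) ^ (4 * k + 5) * Z ^ 3 : ℕ) : ℝ) := by exact_mod_cast hT'
    rw [hZ] at this
    push_cast at this ⊢
    exact this
  have hZr : (1 : ℝ) ≤ (n : ℝ) * m + 1 := by
    have : (0 : ℝ) ≤ (n : ℝ) * m := by positivity
    linarith
  have hCr : (C : ℝ) = 36000 * 8 ^ 9 := by rw [hC]; norm_num
  have hexp : (2 : ℝ) ^ (36 * ((k : ℝ) * Real.logb 2 k)) ≤
      (2 : ℝ) ^ ((C : ℝ) * ((k : ℝ) * Real.logb 2 k)) := by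
    apply Real.rpow_le_rpow_of_exponent_le (by norm_num)
    exact mul_le_mul_of_nonneg_right (by rw [hCr]; norm_num) (mul_logb_nonneg k)
  have hpow := (pow_le_two_rpow k).trans (mul_le_mul_of_nonneg_left hexp (by positivity))
  have hZC : ((n : ℝ) * m + 1) ^ 3 ≤ ((n : ℝ) * m + 1) ^ C :=
    pow_le_pow_right₀ hZr (by omega)
  calc (T : ℝ) ≤ 36000 * ((4 * k + 4 : ℕ) : ℝ) ^ (4 * k + 5) * ((n : ℝ) * m + 1) ^ 3 := hT2
    _ ≤ 36000 * (8 ^ 9 * (2 : ℝ) ^ ((C : ℝ) * ((k : ℝ) * Real.logb 2 k))) *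
        ((n : ℝ) * m + 1) ^ C :=
      mul_le_mul (mul_le_mul_of_nonneg_left hpow (by positivity)) hZC (by positivity)
        (by positivity)
    _ = _ := by rw [hCr, ← mul_assoc]
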